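/- Let $T>0$, $B\in\mathbb R^{n\times m}$, $C\in\mathbb R^{r\times n}$, $x_0\in\mathbb R^n$, and let $(A_k,\Gamma_k,R_k,Q_k)$, $k=1,\dots,N$ ($N\ge 1$), be finitely many tuples of real matrices with $A_k\in\mathbb R^{n\times n}$ arbitrary and $\Gamma_k\in\mathbb R^{n\times n}$, $R_k\in\mathbb R^{m\times m}$, $Q_k\in\mathbb R^{r\times r}$ symmetric positive definite. Let $y\in L^2(0,T;\mathbb R^r)$ and write $\|x\|_M^2=x^\top Mx$. For $t\in(0,T]$ and $\xi\in\mathbb R^n$ let $$\mathcal V_k(t,\xi)=\inf\Big\{\|x(0)-x_0\|_{\Gamma_k^{-1}}^2+\int_0^t\big(\|v(s)\|_{R_k^{-1}}^2+\|y(s)-Cx(s)\|_{Q_k^{-1}}^2\big)\,ds\Big\},$$ the infimum being taken over all $x\in H^1(0,t;\mathbb R^n)$ and $v\in L^2(0,t;\mathbb R^m)$ with $\dot x=A_kx+Bv$ on $(0,t)$ and $x(t)=\xi$; let $\mathcal V_k(0,\xi)=\|\xi-x_0\|_{\Gamma_k^{-1}}^2$. For $t\in[0,T]$ and $\theta\in(0,\infty)$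 let $\widehat x_0(t)$, $\widehat x_\infty(t)$ and $\widehat x_\theta(t)$ denote the unique minimizers over $x\in\mathbb R^n$ of, respectively, $$\frac1N\sum_{k=1}^N\mathcal V_k(t,x),\qquad \max_{1\le k\le N}\mathcal V_k(t,x),\qquad \frac1\theta\ln\Big(\frac1N\sum_{k=1}^N e^{\theta\mathcal V_k(t,x)}\Big).$$ Then: 1. $\widehat x_0\in W^{1,1}(0,T;\mathbb R^n)$, $\widehat x_\theta\in W^{1,1}(0,T;\mathbb R^n)$ for every $\theta\in(0,\infty)$, and $\|\widehat x_\theta-\widehat x_0\|_{W^{1,1}(0,T;\mathbb R^n)}\to 0$ as $\theta\to 0^+$. 2. For every $1\le p<\infty$, $\widehat x_\infty\in L^p(0,T;\mathbb R^n)$, $\widehat x_\theta\in L^p(0,T;\mathbb R^n)$ for every $\theta\in(0,\infty)$, and $\|\widehat x_\theta-\widehat x_\infty\|_{L^p(0,T;\mathbb R^n)}\to 0$ as $\theta\to\infty$. -/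

import Mathlib

open MeasureTheory Set Filter Topology
open scoped ContDiff ENNReal

noncomputable section

namespace RiskAverseKalman

/-- Euclidean space `ℝᵈ`. -/
abbrev E (d : ℕ) : Type := EuclideanSpace ℝ (Fin d)

/-- The weighted square `‖x‖_M² = xᵀ M x`. -/
def sqNorm {d : ℕ} (M : Matrix (Fin d) (Fin d) ℝ) (x : E d) : ℝ :=
  inner ℝ x (M.toEuclideanLin x)

/-- `g` is a weak derivative of `u` on the open interval `(a, b)`. -/
def HasWeakDeriv {d : ℕ} (a b : ℝ) (u g : ℝ → E d) : Prop :=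
  LocallyIntegrableOn u (Ioo a b) ∧ LocallyIntegrableOn g (Ioo a b) ∧
    ∀ φ : ℝ → ℝ, ContDiff ℝ ∞ φ → HasCompactSupport φ → tsupport φ ⊆ Ioo a b →
      ∫ s in Ioo a b, deriv φ s • u s = - ∫ s in Ioo a b, φ s • g s

/-- `u ∈ L^p(a, b; ℝᵈ)`. -/
def MemLpI {d : ℕ} (p : ℝ≥0∞) (a b : ℝ) (u : ℝ → E d) : Prop :=
  MemLp u p (volume.restrict (Ioo a b))

/-- The norm of `L^p(a, b; ℝᵈ)`, with values in `[0, ∞]`. -/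
def normLp {d : ℕ} (p : ℝ≥0∞) (a b : ℝ) (u : ℝ → E d) : ℝ≥0∞ :=
  eLpNorm u p (volume.restrict (Ioo a b))

/-- `u ∈ W^{1,p}(a, b; ℝᵈ)`; for `p = 2` this is `H¹(a, b; ℝᵈ)`. -/
def MemW1 {d : ℕ} (p : ℝ≥0∞) (a b : ℝ) (u : ℝ → E d) : Prop :=
  MemLpI p a b u ∧ ∃ g : ℝ → E d, MemLpI p a b g ∧ HasWeakDeriv a b u g

/-- The weak derivative of `u` on `(a, b)`. It is determined up to a null set of `(a, b)`
whenever it exists (and is meaningless otherwise). -/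
def weakDeriv {d : ℕ} (a b : ℝ) (u : ℝ → E d) : ℝ → E d :=
  Classical.epsilon fun g => HasWeakDeriv a b u g

/-- The norm `‖u‖_{L¹} + ‖u'‖_{L¹}` of `u ∈ W^{1,1}(a, b; ℝᵈ)`. -/
def normW11 {d : ℕ} (a b : ℝ) (u : ℝ → E d) : ℝ≥0∞ :=
  normLp 1 a b u + normLp 1 a b (weakDeriv a b u)

/-- The data of an uncertain linear system: a family of system matrices `A k` and weighting
matrices `Γ k`, `R k`, `Q k` indexed by the finite parameter set, and the known matrices `B`, `C`
and initial guess `x₀`. -/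
structure UncertainSystem (n m r : ℕ) (ι : Type*) where
  A : ι → Matrix (Fin n) (Fin n) ℝ
  Γ : ι → Matrix (Fin n) (Fin n) ℝ
  R : ι → Matrix (Fin m) (Fin m) ℝ
  Q : ι → Matrix (Fin r) (Fin r) ℝ
  B : Matrix (Fin n) (Fin m) ℝ
  C : Matrix (Fin r) (Fin n) ℝ
  x₀ : E n

namespace UncertainSystem

variable {n m r : ℕ} {ι : Type*}

/-- The pair `(x, v) ∈ H¹(0, t; ℝⁿ) × L²(0, t; ℝᵐ)` satisfies `x' = A_k x + B v` on `(0, t)` and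
`x(t) = ξ`. As usual `x ∈ H¹` is identified with its continuous representative on `[0, t]`. -/
def Admissible (S : UncertainSystem n m r ι) (k : ι) (t : ℝ) (ξ : E n)
    (x : ℝ → E n) (v : ℝ → E m) : Prop :=
  ContinuousOn x (Icc 0 t) ∧ MemW1 2 0 t x ∧ MemLpI 2 0 t v ∧
    HasWeakDeriv 0 t x (fun s => (S.A k).toEuclideanLin (x s) + S.B.toEuclideanLin (v s)) ∧
    x t = ξ

/-- The energy `‖x(0) - x₀‖²_{Γ⁻¹} + ∫₀ᵗ ‖v‖²_{R⁻¹} + ‖y - C x‖²_{Q⁻¹} ds` for the parameter `k`. -/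
def cost (S : UncertainSystem n m r ι) (y : ℝ → E r) (k : ι) (t : ℝ)
    (x : ℝ → E n) (v : ℝ → E m) : ℝ :=
  sqNorm (S.Γ k)⁻¹ (x 0 - S.x₀) +
    ∫ s in Ioo 0 t, (sqNorm (S.R k)⁻¹ (v s) + sqNorm (S.Q k)⁻¹ (y s - S.C.toEuclideanLin (x s)))

open Classical in
/-- The value function `𝒱_k(t, ξ)`: for `t > 0` the minimal energy of a trajectory that ends in `ξ`
at time `t`, and `‖ξ - x₀‖²_{Γ⁻¹}` at `t = 0`. -/
def value (S : UncertainSystem n m r ι) (y : ℝ → E r) (k : ι) (t : ℝ) (ξ : E n) : ℝ :=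
  if 0 < t then
    sInf {c : ℝ | ∃ (x : ℝ → E n) (v : ℝ → E m), S.Admissible k t ξ x v ∧ c = S.cost y k t x v}
  else sqNorm (S.Γ k)⁻¹ (ξ - S.x₀)

end UncertainSystem

section Risk

variable {ι : Type*} [Fintype ι] [Nonempty ι]

/-- Expectation under the uniform distribution on the finite parameter set. -/
def expectation (X : ι → ℝ) : ℝ := (1 / (Fintype.card ι : ℝ)) * ∑ k, X k

/-- The worst case: the maximum over the finite parameter set. -/
def worstCase (X : ι → ℝ) : ℝ := Finset.univ.sup' Finset.univ_nonempty X

/-- The entropic risk measure `ρ_θ(X) = θ⁻¹ ln 𝔼[exp(θ X)]`. -/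
def entropicRisk (θ : ℝ) (X : ι → ℝ) : ℝ :=
  (1 / θ) * Real.log (expectation fun k => Real.exp (θ * X k))

end Risk

/-- The minimizer of `f` over `ℝⁿ` (meaningful when there is exactly one). -/
def argmin {n : ℕ} (f : E n → ℝ) : E n := Classical.epsilon fun x => ∀ z, f x ≤ f z

namespace UncertainSystem

variable {n m r : ℕ} {ι : Type*} [Fintype ι] [Nonempty ι]

/-- `x̂_0(t)`, the minimizer of the expected energy. -/
def xhatZero (S : UncertainSystem n m r ι) (y : ℝ → E r) (t : ℝ) : E n :=
  argmin fun x => expectation fun k => S.value y k t x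

/-- `x̂_∞(t)`, the minimizer of the worst case energy. -/
def xhatInfty (S : UncertainSystem n m r ι) (y : ℝ → E r) (t : ℝ) : E n :=
  argmin fun x => worstCase fun k => S.value y k t x

/-- `x̂_θ(t)`, the minimizer of the entropic risk of the energy with risk aversion `θ > 0`. -/
def xhat (S : UncertainSystem n m r ι) (y : ℝ → E r) (θ t : ℝ) : E n :=
  argmin fun x => entropicRisk θ fun k => S.value y k t x

end UncertainSystem

end RiskAverseKalman

end

/-!
A trajectory that solves the Hamiltonian system with the transversality condition at time `0` is
optimal among all trajectories with the same end point, because the cost is a nonnegative quadratic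
form plus an integral that telescopes along it. Hence `𝒱_k(t, ·)` is a quadratic polynomial whose
coefficients are absolutely continuous in `t` and whose leading coefficient is positive definite; by
compactness of `[0, T]` and finiteness of the parameter set, all the `𝒱_k(t, ·)` are strongly convex
with one and the same constant.

The minimizers are the zeros of `∑ₖ exp (θ 𝒱_k) D𝒱_k`, which makes sense down to `θ = 0` and has an
invertible derivative in the state. The implicit function theorem expresses `x̂_θ(t)` as a `C¹`
function of `θ ≥ 0` and of the coefficients at time `t`, and gives the convergence in `W^{1,1}`.

For `θ → ∞`, the entropic risk differs from the worst case by at most `ln N / θ`, so by strong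
convexity the squared distance of the minimizers is `O(1 / θ)`, uniformly in `t`.
-/

noncomputable section

namespace RiskAverseKalman

section Primitive

variable {F G K : Type*} [NormedAddCommGroup F] [NormedSpace ℝ F]
  [NormedAddCommGroup G] [NormedSpace ℝ G] [NormedAddCommGroup K] [NormedSpace ℝ K]
  {a b : ℝ} {u g : ℝ → F}

/-- `u` is absolutely continuous on `[a, b]` with integrable derivative `g`, in integrated form. -/
structure IsPrimitive (a b : ℝ) (u g : ℝ → F) : Prop where
  integrableOn : IntegrableOn g (Ioo a b)
  eq_add_integral : ∀ t ∈ Icc a b, u t = u a + ∫ s in a..t, g s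

theorem intervalIntegrable_of_mem_Icc {F : Type*} [NormedAddCommGroup F] {g : ℝ → F}
    (hg : IntegrableOn g (Ioo a b)) {s t : ℝ} (hs : s ∈ Icc a b) (ht : t ∈ Icc a b) :
    IntervalIntegrable g volume s t :=
  ((intervalIntegrable_iff_integrableOn_Ioo_of_le (hs.1.trans hs.2)).2 hg).mono_set
    (uIcc_subset_uIcc (Icc_subset_uIcc hs) (Icc_subset_uIcc ht))

theorem continuousOn_integral_Icc (hg : IntegrableOn g (Ioo a b)) :
    ContinuousOn (fun t => ∫ s in a..t, g s) (Icc a b) := by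
  rcases lt_or_ge b a with hba | hab
  · simp only [Icc_eq_empty_of_lt hba, continuousOn_empty]
  · simpa only [uIcc_of_le hab] using intervalIntegral.continuousOn_primitive_interval'
      (intervalIntegrable_of_mem_Icc hg ⟨le_rfl, hab⟩ ⟨hab, le_rfl⟩) left_mem_uIcc

namespace IsPrimitive

theorem of_integrableOn (hg : IntegrableOn g (Ioo a b)) (c : F) :
    IsPrimitive a b (fun t => c + ∫ s in a..t, g s) g :=
  ⟨hg, fun t _ => by simp only [intervalIntegral.integral_same, add_zero]⟩

theorem of_hasDerivAt [CompleteSpace F] (hu : ∀ t ∈ Icc a b, HasDerivAt u (g t) t)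
    (hg : ContinuousOn g (Icc a b)) : IsPrimitive a b u g := by
  have hi : IntegrableOn g (Ioo a b) := hg.integrableOn_Icc.mono_set Ioo_subset_Icc_self
  refine ⟨hi, fun t ht => ?_⟩
  have ha : a ∈ Icc a b := ⟨le_rfl, ht.1.trans ht.2⟩
  rw [intervalIntegral.integral_eq_sub_of_hasDerivAt
    (fun s hs => hu s (uIcc_subset_Icc ha ht hs)) (intervalIntegrable_of_mem_Icc hi ha ht),
    add_sub_cancel]

theorem congr (h : IsPrimitive a b u g) {v : ℝ → F} (huv : EqOn v u (Icc a b)) :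
    IsPrimitive a b v g :=
  ⟨h.integrableOn, fun t ht => by
    rw [huv ht, huv ⟨le_rfl, ht.1.trans ht.2⟩, h.eq_add_integral t ht]⟩

theorem congr_deriv (h : IsPrimitive a b u g) {k : ℝ → F} (hk : ∀ t, k t = g t) :
    IsPrimitive a b u k :=
  funext hk ▸ h

theorem mono (h : IsPrimitive a b u g) {t : ℝ} (ht : t ≤ b) : IsPrimitive a t u g :=
  ⟨h.integrableOn.mono_set (Ioo_subset_Ioo_right ht),
    fun s hs => h.eq_add_integral s ⟨hs.1, hs.2.trans ht⟩⟩

theorem continuousOn (h : IsPrimitive a b u g) : ContinuousOn u (Icc a b) :=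
  (continuousOn_const.add (continuousOn_integral_Icc h.integrableOn)).congr h.eq_add_integral

theorem integral_eq_sub (h : IsPrimitive a b u g) {s t : ℝ} (hs : s ∈ Icc a b)
    (ht : t ∈ Icc a b) : ∫ τ in s..t, g τ = u t - u s := by
  have ha : a ∈ Icc a b := ⟨le_rfl, hs.1.trans hs.2⟩
  rw [h.eq_add_integral t ht, h.eq_add_integral s hs, add_sub_add_left_eq_sub,
    intervalIntegral.integral_interval_sub_left (intervalIntegrable_of_mem_Icc h.integrableOn ha ht)
      (intervalIntegrable_of_mem_Icc h.integrableOn ha hs)]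

theorem norm_sub_le (h : IsPrimitive a b u g) {s t : ℝ} (hs : s ∈ Icc a b)
    (ht : t ∈ Icc a b) : ‖u t - u s‖ ≤ |∫ τ in s..t, ‖g τ‖| := by
  rw [← h.integral_eq_sub hs ht]
  exact intervalIntegral.norm_integral_le_abs_integral_norm

theorem add (h : IsPrimitive a b u g) {v k : ℝ → F} (h' : IsPrimitive a b v k) :
    IsPrimitive a b (fun t => u t + v t) (fun t => g t + k t) := by
  refine ⟨h.integrableOn.add h'.integrableOn, fun t ht => ?_⟩
  have ha : a ∈ Icc a b := ⟨le_rfl, ht.1.trans ht.2⟩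
  rw [intervalIntegral.integral_add (intervalIntegrable_of_mem_Icc h.integrableOn ha ht)
    (intervalIntegrable_of_mem_Icc h'.integrableOn ha ht), h.eq_add_integral t ht,
    h'.eq_add_integral t ht, add_add_add_comm]

theorem clm [CompleteSpace F] [CompleteSpace G] (h : IsPrimitive a b u g) (L : F →L[ℝ] G) :
    IsPrimitive a b (fun t => L (u t)) (fun t => L (g t)) := by
  refine ⟨L.integrable_comp h.integrableOn, fun t ht => ?_⟩
  rw [h.eq_add_integral t ht, map_add, L.intervalIntegral_comp_comm
    (intervalIntegrable_of_mem_Icc h.integrableOn ⟨le_rfl, ht.1.trans ht.2⟩ ht)]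

theorem sub [CompleteSpace F] (h : IsPrimitive a b u g) {v k : ℝ → F} (h' : IsPrimitive a b v k) :
    IsPrimitive a b (fun t => u t - v t) (fun t => g t - k t) := by
  simpa [sub_eq_add_neg] using h.add (h'.clm (-ContinuousLinearMap.id ℝ F))

theorem prodMk [CompleteSpace F] [CompleteSpace G] (h : IsPrimitive a b u g) {v k : ℝ → G}
    (h' : IsPrimitive a b v k) : IsPrimitive a b (fun t => (u t, v t)) (fun t => (g t, k t)) := by
  simpa using (h.clm (ContinuousLinearMap.inl ℝ F G)).add (h'.clm (ContinuousLinearMap.inr ℝ F G))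

theorem pi {ι : Type*} [Fintype ι] [CompleteSpace F] {u g : ι → ℝ → F}
    (h : ∀ i, IsPrimitive a b (u i) (g i)) :
    IsPrimitive a b (fun t i => u i t) (fun t i => g i t) := by
  have hg : IntegrableOn (fun t i => g i t) (Ioo a b) :=
    Integrable.of_eval fun i => (h i).integrableOn
  refine ⟨hg, fun t ht => funext fun i => ?_⟩
  let proj : (ι → F) →L[ℝ] F := .proj i
  have hproj := proj.intervalIntegral_comp_comm
    (intervalIntegrable_of_mem_Icc hg ⟨le_rfl, ht.1.trans ht.2⟩ ht)
  rw [(h i).eq_add_integral t ht, Pi.add_apply]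
  exact congrArg _ hproj

end IsPrimitive

theorem absolutelyContinuousOnInterval_of_dist_le {X Y : Type*} [PseudoMetricSpace X]
    [PseudoMetricSpace Y] {f : ℝ → X} {h : ℝ → Y} (hh : AbsolutelyContinuousOnInterval h a b)
    (hf : ∀ s ∈ uIcc a b, ∀ t ∈ uIcc a b, dist (f s) (f t) ≤ dist (h s) (h t)) :
    AbsolutelyContinuousOnInterval f a b := by
  rw [absolutelyContinuousOnInterval_iff] at hh ⊢
  intro ε hε
  obtain ⟨δ, hδ, hsum⟩ := hh ε hε
  exact ⟨δ, hδ, fun I hI hlen => (Finset.sum_le_sum fun i hi =>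
    hf _ (hI.1 i hi).1 _ (hI.1 i hi).2).trans_lt (hsum I hI hlen)⟩

theorem IsPrimitive.absolutelyContinuousOnInterval (h : IsPrimitive a b u g) (hab : a ≤ b) :
    AbsolutelyContinuousOnInterval u a b := by
  have hint : ∀ s ∈ Icc a b, IntervalIntegrable (fun τ => ‖g τ‖) volume a s := fun s hs =>
    intervalIntegrable_of_mem_Icc h.integrableOn.norm ⟨le_rfl, hab⟩ hs
  refine absolutelyContinuousOnInterval_of_dist_le
    ((hint b ⟨hab, le_rfl⟩).absolutelyContinuousOnInterval_intervalIntegral left_mem_uIcc) ?_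
  intro s hs t ht
  rw [uIcc_of_le hab] at hs ht
  rw [dist_comm, dist_eq_norm, dist_comm, Real.dist_eq,
    intervalIntegral.integral_interval_sub_left (hint t ht) (hint s hs)]
  exact h.norm_sub_le hs ht

theorem IsPrimitive.ae_hasDerivAt [CompleteSpace F] (h : IsPrimitive a b u g) :
    ∀ᵐ t, t ∈ Ioo a b → HasDerivAt u (g t) t := by
  rcases le_or_gt b a with hba | hab
  · simp [Ioo_eq_empty_of_le hba]
  have hint := intervalIntegrable_of_mem_Icc h.integrableOn ⟨le_rfl, hab.le⟩ ⟨hab.le, le_rfl⟩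
  filter_upwards [hint.ae_hasDerivAt_integral] with t hderiv ht
  have hu : u =ᶠ[𝓝 t] fun t => u a + ∫ s in a..t, g s := by
    filter_upwards [Icc_mem_nhds ht.1 ht.2] with s hs using h.eq_add_integral s hs
  exact ((hderiv (Icc_subset_uIcc (Ioo_subset_Icc_self ht)) a left_mem_uIcc).const_add _
    ).congr_of_eventuallyEq hu

theorem norm_sub_le_of_locally {F : Type*} [NormedAddCommGroup F] {e : ℝ → F} {h : ℝ → ℝ}
    (he : ContinuousOn e (Icc a b)) (hh : ContinuousOn h (Icc a b)) (hab : a ≤ b)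
    (hloc : ∀ t ∈ Ico a b, ∀ᶠ s in 𝓝[>] t, ‖e s - e t‖ ≤ h s - h t) :
    ‖e b - e a‖ ≤ h b - h a := by
  have key : Icc a b ⊆ {t | ‖e t - e a‖ ≤ h t - h a} := by
    refine IsClosed.Icc_subset_of_forall_mem_nhdsWithin ?_ (by simp) ?_
    · rw [inter_comm]
      exact isClosed_Icc.isClosed_le (he.sub continuousOn_const).norm (hh.sub continuousOn_const)
    · rintro t ⟨ht, htI⟩
      filter_upwards [hloc t htI] with s hs
      calc ‖e s - e a‖ ≤ ‖e s - e t‖ + ‖e t - e a‖ := norm_sub_le_norm_sub_add_norm_sub ..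
        _ ≤ (h s - h t) + (h t - h a) := add_le_add hs ht
        _ = h s - h a := sub_add_sub_cancel ..
  exact key ⟨hab, le_rfl⟩

theorem integrableOn_clm_apply (hg : IntegrableOn g (Ioo a b)) {L : ℝ → F →L[ℝ] G}
    (hL : ContinuousOn L (Icc a b)) : IntegrableOn (fun t => L t (g t)) (Ioo a b) := by
  obtain ⟨K, hK⟩ := isCompact_Icc.exists_bound_of_continuousOn hL
  have hLm : AEStronglyMeasurable L (volume.restrict (Ioo a b)) :=
    (hL.aestronglyMeasurable_of_isCompact isCompact_Icc measurableSet_Icc).mono_measure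
      (Measure.restrict_mono Ioo_subset_Icc_self le_rfl)
  refine Integrable.mono' (hg.norm.const_mul K) ?_ ?_
  · exact (ContinuousLinearMap.apply ℝ G : F →L[ℝ] (F →L[ℝ] G) →L[ℝ] G).aestronglyMeasurable_comp₂
      hg.aestronglyMeasurable hLm
  · filter_upwards [ae_restrict_mem measurableSet_Ioo] with t ht
    exact (L t).le_of_opNorm_le (hK t (Ioo_subset_Icc_self ht)) _

theorem hasDerivAt_of_isLittleO_sub {c : ℝ → F} {c' : F} {u : ℝ → G} {L : F →L[ℝ] G} {t : ℝ}
    (hc : HasDerivAt c c' t)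
    (hu : (fun s => u s - u t - L (c s - c t)) =o[𝓝 t] fun s => c s - c t) :
    HasDerivAt u (L c') t := by
  have hLc : HasDerivAt (fun s => L (c s)) (L c') t := L.hasFDerivAt.comp_hasDerivAt t hc
  rw [hasDerivAt_iff_isLittleO] at hLc ⊢
  refine ((hu.trans_isBigO hc.differentiableAt.isBigO_sub).add hLc).congr_left fun s => ?_
  rw [map_sub]
  abel

theorem continuousOn_of_isLittleO_sub {c : ℝ → F} {u : ℝ → G} {L : ℝ → F →L[ℝ] G} {s : Set ℝ}
    (hc : ContinuousOn c s)
    (hu : ∀ t ∈ s, (fun τ => u τ - u t - L t (c τ - c t)) =o[𝓝[s] t] fun τ => c τ - c t) :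
    ContinuousOn u s := by
  intro t ht
  have hsub : Tendsto (fun τ => c τ - c t) (𝓝[s] t) (𝓝 0) := tendsto_sub_nhds_zero_iff.2 (hc t ht)
  have hlin : Tendsto (fun τ => L t (c τ - c t)) (𝓝[s] t) (𝓝 0) :=
    ((L t).continuous.tendsto' 0 0 (map_zero _)).comp hsub
  refine tendsto_sub_nhds_zero_iff.1 ?_
  simpa using ((hu t ht).trans_tendsto hsub).add hlin

namespace IsPrimitive

section ChainRule

variable {c c' : ℝ → F} {u : ℝ → G} {L : ℝ → F →L[ℝ] G}

theorem norm_sub_le_of_isLittleO (hc : IsPrimitive a b c c') {M : ℝ}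
    (hM : ∀ t ∈ Icc a b, ‖L t‖ ≤ M)
    (hu : ∀ t ∈ Icc a b,
      (fun s => u s - u t - L t (c s - c t)) =o[𝓝[Icc a b] t] fun s => c s - c t)
    {s t : ℝ} (hs : s ∈ Icc a b) (ht : t ∈ Icc a b) (hst : s ≤ t) :
    ‖u t - u s‖ ≤ ∫ τ in s..t, (M + 1) * ‖c' τ‖ := by
  have hprim := of_integrableOn (hc.integrableOn.norm.const_mul (M + 1)) 0
  have hsub : Icc s t ⊆ Icc a b := Icc_subset_Icc hs.1 ht.2
  rw [hprim.integral_eq_sub hs ht]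
  refine norm_sub_le_of_locally ((continuousOn_of_isLittleO_sub hc.continuousOn hu).mono hsub)
    (hprim.continuousOn.mono hsub) hst fun τ hτ => ?_
  have hτ' : τ ∈ Icc a b := hsub (Ico_subset_Icc_self hτ)
  have hM0 : 0 ≤ M := (norm_nonneg _).trans (hM τ hτ')
  have hnear : ∀ᶠ σ in 𝓝[>] τ, σ ∈ Ioc τ t := Ioc_mem_nhdsGT hτ.2
  have hIcc : ∀ σ ∈ Ioc τ t, σ ∈ Icc a b := fun σ hσ => hsub ⟨hτ.1.trans hσ.1.le, hσ.2⟩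
  have hle : 𝓝[>] τ ≤ 𝓝[Icc a b] τ := le_inf inf_le_left (le_principal_iff.2 (by
    filter_upwards [hnear] using hIcc))
  filter_upwards [hnear, hle ((hu τ hτ').def one_pos)] with σ hσ hclose
  rw [← hprim.integral_eq_sub hτ' (hIcc σ hσ), intervalIntegral.integral_const_mul]
  calc ‖u σ - u τ‖ ≤ ‖u σ - u τ - L τ (c σ - c τ)‖ + ‖L τ (c σ - c τ)‖ :=
        norm_le_norm_sub_add _ _
    _ ≤ 1 * ‖c σ - c τ‖ + M * ‖c σ - c τ‖ :=
        add_le_add hclose ((L τ).le_of_opNorm_le (hM τ hτ') _)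
    _ = (M + 1) * ‖c σ - c τ‖ := by ring
    _ ≤ (M + 1) * ∫ τ in τ..σ, ‖c' τ‖ := by
        gcongr
        refine (hc.norm_sub_le hτ' (hIcc σ hσ)).trans_eq (abs_of_nonneg ?_)
        exact intervalIntegral.integral_nonneg hσ.1.le fun _ _ => norm_nonneg _

theorem absolutelyContinuousOnInterval_of_isLittleO (hc : IsPrimitive a b c c') (hab : a ≤ b)
    (hL : ContinuousOn L (Icc a b))
    (hu : ∀ t ∈ Icc a b,
      (fun s => u s - u t - L t (c s - c t)) =o[𝓝[Icc a b] t] fun s => c s - c t) :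
    AbsolutelyContinuousOnInterval u a b := by
  obtain ⟨M, hM⟩ := isCompact_Icc.exists_bound_of_continuousOn hL
  have hprim := of_integrableOn (hc.integrableOn.norm.const_mul (M + 1)) 0
  refine absolutelyContinuousOnInterval_of_dist_le (hprim.absolutelyContinuousOnInterval hab) ?_
  rw [uIcc_of_le hab]
  intro s hs t ht
  wlog hst : s ≤ t generalizing s t
  · simpa only [dist_comm] using this t ht s hs (le_of_not_ge hst)
  rw [dist_comm, dist_eq_norm, dist_comm, Real.dist_eq, ← hprim.integral_eq_sub hs ht]
  exact (hc.norm_sub_le_of_isLittleO hM hu hs ht hst).trans (le_abs_self _)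

/-- The `o`-condition is the hypothesis `u = f ∘ c` of the chain rule, `L t` being the derivative of
`f` at `c t`, in a form that lets `f` depend on `t`. -/
theorem chain [CompleteSpace F] [CompleteSpace G] (hc : IsPrimitive a b c c')
    (hL : ContinuousOn L (Icc a b))
    (hu : ∀ t ∈ Icc a b,
      (fun s => u s - u t - L t (c s - c t)) =o[𝓝[Icc a b] t] fun s => c s - c t) :
    IsPrimitive a b u (fun t => L t (c' t)) := by
  have hprim := of_integrableOn (integrableOn_clm_apply hc.integrableOn hL) 0
  refine ⟨hprim.integrableOn, fun t ht => ?_⟩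
  have hab : a ≤ b := ht.1.trans ht.2
  have hac := (hc.absolutelyContinuousOnInterval_of_isLittleO hab hL hu).sub
    (hprim.absolutelyContinuousOnInterval hab)
  obtain ⟨C, hC⟩ := hac.const_of_ae_hasDerivAt_zero (by
    filter_upwards [hc.ae_hasDerivAt, hprim.ae_hasDerivAt, compl_mem_ae_iff.2 (measure_singleton a),
      compl_mem_ae_iff.2 (measure_singleton b)] with s hcs hprims hsa hsb hs
    rw [uIcc_of_le hab] at hs
    have hs' : s ∈ Ioo a b := ⟨hs.1.lt_of_ne' hsa, hs.2.lt_of_ne hsb⟩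
    have hus := hu s hs
    rw [nhdsWithin_eq_nhds.2 (Icc_mem_nhds hs'.1 hs'.2)] at hus
    simpa using (hasDerivAt_of_isLittleO_sub (hcs hs') hus).sub (hprims hs'))
  have hta := (hC t (Icc_subset_uIcc ht)).trans (hC a left_mem_uIcc).symm
  simpa [sub_eq_iff_eq_add, add_comm] using hta

end ChainRule

variable [CompleteSpace F] [CompleteSpace G] [CompleteSpace K]

theorem comp_contDiffAt {c c' : ℝ → F} (hc : IsPrimitive a b c c') {f : F → G}
    (hf : ∀ t ∈ Icc a b, ContDiffAt ℝ 1 f (c t)) :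
    IsPrimitive a b (fun t => f (c t)) (fun t => fderiv ℝ f (c t) (c' t)) :=
  hc.chain
    (fun t ht => ((hf t ht).fderiv_right (m := 0) le_rfl).continuousAt.comp_continuousWithinAt
      (hc.continuousOn t ht))
    fun t ht => ((hf t ht).differentiableAt one_ne_zero).hasFDerivAt.isLittleO.comp_tendsto
      (hc.continuousOn t ht)

theorem bilin {u u' : ℝ → F} {v v' : ℝ → G} (B : F →L[ℝ] G →L[ℝ] K) (hu : IsPrimitive a b u u')
    (hv : IsPrimitive a b v v') :
    IsPrimitive a b (fun t => B (u t) (v t)) (fun t => B (u t) (v' t) + B (u' t) (v t)) := by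
  have hB := B.isBoundedBilinearMap
  simpa only [(hB.hasFDerivAt _).fderiv, IsBoundedBilinearMap.deriv_apply] using!
    (hu.prodMk hv).comp_contDiffAt (f := fun p : F × G => B p.1 p.2)
      fun _ _ => hB.contDiff.contDiffAt

theorem inner {H : Type*} [NormedAddCommGroup H] [InnerProductSpace ℝ H] [CompleteSpace H]
    {u u' v v' : ℝ → H} (hu : IsPrimitive a b u u') (hv : IsPrimitive a b v v') :
    IsPrimitive a b (fun t => inner ℝ (u t) (v t))
      (fun t => inner ℝ (u t) (v' t) + inner ℝ (u' t) (v t)) :=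
  hu.bilin (innerSL ℝ) hv

end IsPrimitive

end Primitive

section WeakDerivative

variable {F : Type*} [NormedAddCommGroup F] {a b : ℝ}

theorem memLp_of_continuousOn_Icc {p : ℝ≥0∞} {f : ℝ → F} (hf : ContinuousOn f (Icc a b)) :
    MemLp f p (volume.restrict (Ioo a b)) := by
  obtain ⟨M, hM⟩ := isCompact_Icc.exists_bound_of_continuousOn hf
  refine MemLp.of_bound ((hf.aestronglyMeasurable_of_isCompact isCompact_Icc
    measurableSet_Icc).mono_measure (Measure.restrict_mono Ioo_subset_Icc_self le_rfl)) M ?_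
  filter_upwards [ae_restrict_mem measurableSet_Ioo] with t ht using hM t (Ioo_subset_Icc_self ht)

theorem integral_Ioo_eq_intervalIntegral [NormedSpace ℝ F] (hab : a ≤ b) (f : ℝ → F) :
    ∫ s in Ioo a b, f s = ∫ s in a..b, f s := by
  rw [intervalIntegral.integral_of_le hab, integral_Ioc_eq_integral_Ioo]

theorem eq_zero_of_tsupport_subset {φ : ℝ → ℝ} {U : Set ℝ} (hφ : tsupport φ ⊆ U) {t : ℝ}
    (ht : t ∉ U) : φ t = 0 :=
  image_eq_zero_of_notMem_tsupport fun h => ht (hφ h)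

variable [NormedSpace ℝ F]

theorem integrableOn_smul_of_tsupport_subset {U : Set ℝ} (hU : MeasurableSet U) {φ : ℝ → ℝ}
    (hφ : Continuous φ) (hφc : HasCompactSupport φ) (hφU : tsupport φ ⊆ U) {k : ℝ → F}
    (hk : LocallyIntegrableOn k U) : IntegrableOn (fun s => φ s • k s) U :=
  ((hk.integrableOn_compact_subset hφU hφc).continuousOn_smul hφ.continuousOn hφc
    ).of_forall_sdiff_eq_zero hU fun x hx => by
      rw [image_eq_zero_of_notMem_tsupport hx.2, zero_smul]

theorem integrableOn_deriv_smul_of_tsupport_subset {U : Set ℝ} (hU : MeasurableSet U) {φ : ℝ → ℝ}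
    (hφ : ContDiff ℝ ∞ φ) (hφc : HasCompactSupport φ) (hφU : tsupport φ ⊆ U) {k : ℝ → F}
    (hk : LocallyIntegrableOn k U) : IntegrableOn (fun s => deriv φ s • k s) U :=
  integrableOn_smul_of_tsupport_subset hU (hφ.continuous_deriv (by exact_mod_cast le_top)) hφc.deriv
    (tsupport_deriv_subset.trans hφU) hk

theorem setIntegral_smul_eq_integral_of_tsupport_subset {U : Set ℝ} {φ : ℝ → ℝ}
    (hφU : tsupport φ ⊆ U) (k : ℝ → F) : ∫ s in U, φ s • k s = ∫ s, φ s • k s :=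
  setIntegral_eq_integral_of_forall_compl_eq_zero fun x hx => by
    rw [eq_zero_of_tsupport_subset hφU hx, zero_smul]

theorem exists_contDiff_deriv_eq_of_integral_eq_zero {χ : ℝ → ℝ} (hχ : ContDiff ℝ ∞ χ)
    (hχc : HasCompactSupport χ) (hχU : tsupport χ ⊆ Ioo a b) (hχ0 : ∫ t, χ t = 0) :
    ∃ Φ : ℝ → ℝ, ContDiff ℝ ∞ Φ ∧ HasCompactSupport Φ ∧ tsupport Φ ⊆ Ioo a b ∧ deriv Φ = χ := by
  rcases (tsupport χ).eq_empty_or_nonempty with hempty | hne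
  · obtain rfl : χ = 0 := tsupport_eq_empty_iff.1 hempty
    exact ⟨0, hχ, hχc, hχU, deriv_zero⟩
  set c := sInf (tsupport χ)
  set d := sSup (tsupport χ)
  have hc : c ∈ Ioo a b := hχU (hχc.sInf_mem hne)
  have hd : d ∈ Ioo a b := hχU (hχc.sSup_mem hne)
  have hχcd : tsupport χ ⊆ Icc c d := fun t ht =>
    ⟨csInf_le hχc.bddBelow ht, le_csSup hχc.bddAbove ht⟩
  have hderiv : ∀ t, HasDerivAt (fun t => ∫ s in a..t, χ s) (χ t) t := fun t =>
    (hχ.continuous.integral_hasStrictDerivAt a t).hasDerivAt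
  have hderiv_eq : deriv (fun t => ∫ s in a..t, χ s) = χ := funext fun t => (hderiv t).deriv
  have hΦcd : tsupport (fun t => ∫ s in a..t, χ s) ⊆ Icc c d := by
    refine closure_minimal (fun t ht => ?_) isClosed_Icc
    by_contra htcd
    refine ht (show ∫ s in a..t, χ s = 0 from ?_)
    rcases lt_or_ge t c with htc | hct
    · rw [intervalIntegral.integral_congr (g := fun _ => 0), intervalIntegral.integral_zero]
      intro s hs
      refine eq_zero_of_tsupport_subset hχcd fun hscd => hscd.1.not_gt ?_
      exact hs.2.trans_lt (max_lt hc.1 htc)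
    · have hdt : d < t := lt_of_not_ge fun htd => htcd ⟨hct, htd⟩
      refine (intervalIntegral.integral_eq_integral_of_support_subset ?_).trans hχ0
      exact (subset_tsupport χ).trans fun s hs =>
        ⟨hc.1.trans_le (hχcd hs).1, (hχcd hs).2.trans hdt.le⟩
  refine ⟨_, contDiff_infty_iff_deriv.2 ⟨fun t => (hderiv t).differentiableAt, ?_⟩,
    isCompact_Icc.of_isClosed_subset (isClosed_tsupport _) hΦcd,
    hΦcd.trans (Icc_subset_Ioo hc.1 hd.2), hderiv_eq⟩
  rwa [hderiv_eq]

theorem exists_contDiff_integral_eq_one (hab : a < b) :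
    ∃ φ : ℝ → ℝ, ContDiff ℝ ∞ φ ∧ HasCompactSupport φ ∧ tsupport φ ⊆ Ioo a b ∧ ∫ t, φ t = 1 := by
  let β : ContDiffBump ((a + b) / 2) :=
    ⟨(b - a) / 8, (b - a) / 4, by linarith, by linarith⟩
  refine ⟨β.normed volume, β.contDiff_normed, β.hasCompactSupport_normed, ?_, β.integral_normed⟩
  rw [β.tsupport_normed_eq, Real.closedBall_eq_Icc]
  exact Icc_subset_Ioo (by simp only [β]; linarith) (by simp only [β]; linarith)

theorem exists_contDiff_deriv_eq_sub {φ φ₀ : ℝ → ℝ} (hφ : ContDiff ℝ ∞ φ)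
    (hφc : HasCompactSupport φ) (hφU : tsupport φ ⊆ Ioo a b) (hφ₀ : ContDiff ℝ ∞ φ₀)
    (hφ₀c : HasCompactSupport φ₀) (hφ₀U : tsupport φ₀ ⊆ Ioo a b) (hφ₀1 : ∫ t, φ₀ t = 1) :
    ∃ Φ : ℝ → ℝ, ContDiff ℝ ∞ Φ ∧ HasCompactSupport Φ ∧ tsupport Φ ⊆ Ioo a b ∧
      deriv Φ = fun t => φ t - (∫ s, φ s) * φ₀ t := by
  refine exists_contDiff_deriv_eq_of_integral_eq_zero (hφ.sub (contDiff_const.mul hφ₀))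
    (hφc.sub hφ₀c.mul_left) ?_ ?_
  · exact (tsupport_sub φ _).trans (union_subset hφU
      ((closure_mono (Function.support_mul_subset_right _ _)).trans hφ₀U))
  · rw [integral_sub (hφ.continuous.integrable_of_hasCompactSupport hφc)
      ((hφ₀.continuous.integrable_of_hasCompactSupport hφ₀c).const_mul _), integral_const_mul,
      hφ₀1, mul_one, sub_self]

theorem ae_eq_const_of_integral_deriv_smul_eq_zero [CompleteSpace F] (hab : a < b) {v : ℝ → F}
    (hv : LocallyIntegrableOn v (Ioo a b))
    (h : ∀ φ : ℝ → ℝ, ContDiff ℝ ∞ φ → HasCompactSupport φ → tsupport φ ⊆ Ioo a b →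
      ∫ s in Ioo a b, deriv φ s • v s = 0) :
    ∃ c : F, v =ᵐ[volume.restrict (Ioo a b)] fun _ => c := by
  obtain ⟨φ₀, hφ₀, hφ₀c, hφ₀U, hφ₀1⟩ := exists_contDiff_integral_eq_one hab
  set c := ∫ s in Ioo a b, φ₀ s • v s with hc
  have hconst : LocallyIntegrableOn (fun _ : ℝ => c) (Ioo a b) :=
    (locallyIntegrable_const c).locallyIntegrableOn _
  refine ⟨c, (ae_restrict_iff' measurableSet_Ioo).2 ?_⟩
  have key := isOpen_Ioo.ae_eq_zero_of_integral_contDiff_smul_eq_zero (hv.sub hconst)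
    fun φ hφ hφc hφU => ?_
  · filter_upwards [key] with t ht htU using sub_eq_zero.1 (ht htU)
  obtain ⟨Φ, hΦ, hΦc, hΦU, hΦ'⟩ := exists_contDiff_deriv_eq_sub hφ hφc hφU hφ₀ hφ₀c hφ₀U hφ₀1
  have h0 := h Φ hΦ hΦc hΦU
  simp only [hΦ', sub_smul, mul_smul] at h0
  have hint : ∀ {ψ : ℝ → ℝ} {k : ℝ → F}, ContDiff ℝ ∞ ψ → HasCompactSupport ψ →
      tsupport ψ ⊆ Ioo a b → LocallyIntegrableOn k (Ioo a b) →
      IntegrableOn (fun s => ψ s • k s) (Ioo a b) := fun hψ hψc hψU =>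
    integrableOn_smul_of_tsupport_subset measurableSet_Ioo hψ.continuous hψc hψU
  have hφ₀v : IntegrableOn (fun s => (∫ t, φ t) • φ₀ s • v s) (Ioo a b) :=
    (hint hφ₀ hφ₀c hφ₀U hv).smul _
  rw [integral_sub (hint hφ hφc hφU hv) hφ₀v, integral_smul, ← hc] at h0
  rw [← setIntegral_smul_eq_integral_of_tsupport_subset hφU]
  simp only [Pi.sub_apply, smul_sub]
  rw [integral_sub (hint hφ hφc hφU hv) (hint hφ hφc hφU hconst),
    setIntegral_smul_eq_integral_of_tsupport_subset hφU (fun _ => c), integral_smul_const, h0]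

variable {n : ℕ} {u g : ℝ → E n}

theorem IsPrimitive.hasWeakDeriv (hab : a ≤ b) (h : IsPrimitive a b u g) :
    HasWeakDeriv a b u g := by
  have hg := h.integrableOn.locallyIntegrableOn
  have hu := (h.continuousOn.mono Ioo_subset_Icc_self).locallyIntegrableOn measurableSet_Ioo
    (μ := volume)
  refine ⟨hu, hg, fun φ hφ hφc hφU => ?_⟩
  have hφ1 : ContDiff ℝ 1 φ := hφ.of_le (by exact_mod_cast le_top)
  have hφu := (of_hasDerivAt (fun t _ => (hφ1.differentiable one_ne_zero t).hasDerivAt)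
    (hφ1.continuous_deriv le_rfl).continuousOn).bilin
      (ContinuousLinearMap.lsmul ℝ ℝ : ℝ →L[ℝ] E n →L[ℝ] E n) h
  have hparts := hφu.integral_eq_sub (left_mem_Icc.2 hab) (right_mem_Icc.2 hab)
  rw [← integral_Ioo_eq_intervalIntegral hab] at hparts
  simp only [ContinuousLinearMap.lsmul_apply, eq_zero_of_tsupport_subset hφU left_notMem_Ioo,
    eq_zero_of_tsupport_subset hφU right_notMem_Ioo, zero_smul, sub_self] at hparts
  rw [integral_add
    (integrableOn_smul_of_tsupport_subset measurableSet_Ioo hφ.continuous hφc hφU hg)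
    (integrableOn_deriv_smul_of_tsupport_subset measurableSet_Ioo hφ hφc hφU hu)] at hparts
  exact eq_neg_of_add_eq_zero_right hparts

theorem HasWeakDeriv.isPrimitive (hab : a < b) (hu : ContinuousOn u (Icc a b))
    (hw : HasWeakDeriv a b u g) (hg : IntegrableOn g (Ioo a b)) : IsPrimitive a b u g := by
  have hG := IsPrimitive.of_integrableOn hg (u a)
  have hGw := hG.hasWeakDeriv hab.le
  obtain ⟨c, hc⟩ := ae_eq_const_of_integral_deriv_smul_eq_zero hab (hw.1.sub hGw.1)
    fun φ hφ hφc hφU => by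
      simp only [Pi.sub_apply, smul_sub]
      rw [integral_sub
        (integrableOn_deriv_smul_of_tsupport_subset measurableSet_Ioo hφ hφc hφU hw.1)
        (integrableOn_deriv_smul_of_tsupport_subset measurableSet_Ioo hφ hφc hφU hGw.1),
        hw.2.2 φ hφ hφc hφU, hGw.2.2 φ hφ hφc hφU, sub_self]
  rw [Measure.restrict_congr_set Ioo_ae_eq_Icc] at hc
  have hconst := Measure.eqOn_Icc_of_ae_eq volume hab.ne hc (hu.sub hG.continuousOn)
    continuousOn_const
  have hc0 : c = 0 := by simpa using (hconst (left_mem_Icc.2 hab.le)).symm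
  exact hG.congr fun t ht => sub_eq_zero.1 ((hconst ht).trans hc0)

theorem HasWeakDeriv.ae_eq {g' : ℝ → E n} (h : HasWeakDeriv a b u g)
    (h' : HasWeakDeriv a b u g') : g =ᵐ[volume.restrict (Ioo a b)] g' := by
  rw [EventuallyEq, ae_restrict_iff' measurableSet_Ioo]
  have key := isOpen_Ioo.ae_eq_zero_of_integral_contDiff_smul_eq_zero (h.2.1.sub h'.2.1)
    fun φ hφ hφc hφU => ?_
  · filter_upwards [key] with t ht htU using sub_eq_zero.1 (ht htU)
  rw [← setIntegral_smul_eq_integral_of_tsupport_subset hφU]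
  simp only [Pi.sub_apply, smul_sub]
  rw [integral_sub
    (integrableOn_smul_of_tsupport_subset measurableSet_Ioo hφ.continuous hφc hφU h.2.1)
    (integrableOn_smul_of_tsupport_subset measurableSet_Ioo hφ.continuous hφc hφU h'.2.1),
    sub_eq_zero, ← neg_inj, ← h.2.2 φ hφ hφc hφU, ← h'.2.2 φ hφ hφc hφU]

theorem HasWeakDeriv.weakDeriv_ae_eq (h : HasWeakDeriv a b u g) :
    weakDeriv a b u =ᵐ[volume.restrict (Ioo a b)] g :=
  HasWeakDeriv.ae_eq (Classical.epsilon_spec (p := HasWeakDeriv a b u) ⟨g, h⟩) h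

theorem IsPrimitive.memW1 (hab : a ≤ b) (h : IsPrimitive a b u g) {p : ℝ≥0∞}
    (hg : MemLpI p a b g) : MemW1 p a b u :=
  ⟨memLp_of_continuousOn_Icc h.continuousOn, g, hg, h.hasWeakDeriv hab⟩

theorem IsPrimitive.normW11_eq (hab : a ≤ b) (h : IsPrimitive a b u g) :
    normW11 a b u = normLp 1 a b u + normLp 1 a b g := by
  rw [normW11, normLp, normLp, normLp, eLpNorm_congr_ae (h.hasWeakDeriv hab).weakDeriv_ae_eq]

end WeakDerivative

section LinearFlow

variable {K : Type*} [NormedAddCommGroup K] [NormedSpace ℝ K]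

/-- The flow of the linear differential equation `z' = L z`. -/
def linearFlow (L : K →L[ℝ] K) (t : ℝ) : K →L[ℝ] K := NormedSpace.exp (t • L)

/-- The solution of `z' = L z + f` with `z 0 = z₀`, given by variation of constants. -/
def linearSolution (L : K →L[ℝ] K) (z₀ : K) (f : ℝ → K) (t : ℝ) : K :=
  linearFlow L t (z₀ + ∫ s in (0 : ℝ)..t, linearFlow L (-s) (f s))

variable (L : K →L[ℝ] K) (z₀ : K) {f : ℝ → K}

theorem linearFlow_zero : linearFlow L 0 = ContinuousLinearMap.id ℝ K := by
  rw [linearFlow, zero_smul, NormedSpace.exp_zero]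
  rfl

theorem linearSolution_zero : linearSolution L z₀ f 0 = z₀ := by
  rw [linearSolution, linearFlow_zero, intervalIntegral.integral_same, add_zero]
  rfl

variable [CompleteSpace K] (T : ℝ)

theorem hasDerivAt_linearFlow (t : ℝ) : HasDerivAt (linearFlow L) (L ∘L linearFlow L t) t :=
  hasDerivAt_exp_smul_const' L t

theorem continuous_linearFlow : Continuous (linearFlow L) :=
  continuous_iff_continuousAt.2 fun t => (hasDerivAt_linearFlow L t).continuousAt

theorem linearFlow_linearFlow_neg (t : ℝ) (z : K) : linearFlow L t (linearFlow L (-t) z) = z := by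
  let : NormedAlgebra ℚ (K →L[ℝ] K) := NormedAlgebra.restrictScalars ℚ ℝ _
  have h := NormedSpace.exp_add_of_commute (Commute.neg_right (Commute.refl (t • L)))
  rw [add_neg_cancel, NormedSpace.exp_zero, ← neg_smul] at h
  exact (DFunLike.congr_fun h z).symm

theorem isPrimitive_linearFlow : IsPrimitive 0 T (linearFlow L) (fun t => L ∘L linearFlow L t) :=
  .of_hasDerivAt (fun t _ => hasDerivAt_linearFlow L t)
    (continuous_const.clm_comp (continuous_linearFlow L)).continuousOn

variable {T}

theorem isPrimitive_linearSolution (hf : IntegrableOn f (Ioo 0 T)) :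
    IsPrimitive 0 T (linearSolution L z₀ f) (fun t => L (linearSolution L z₀ f t) + f t) := by
  have hi := integrableOn_clm_apply hf
    ((continuous_linearFlow L).comp continuous_neg).continuousOn
  refine ((isPrimitive_linearFlow L T).bilin (ContinuousLinearMap.id ℝ _)
    (IsPrimitive.of_integrableOn hi z₀)).congr_deriv fun t => ?_
  simp only [ContinuousLinearMap.id_apply, Function.comp_apply, linearFlow_linearFlow_neg,
    ContinuousLinearMap.comp_apply, linearSolution, add_comm]

end LinearFlow

theorem integrable_inner_of_memLp {K α : Type*} [NormedAddCommGroup K] [InnerProductSpace ℝ K]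
    [MeasurableSpace α] {μ : Measure α} {f g : α → K} (hf : MemLp f 2 μ) (hg : MemLp g 2 μ) :
    Integrable (fun x => inner ℝ (f x) (g x)) μ :=
  (hf.norm.integrable_mul hg.norm).mono' (hf.1.inner hg.1)
    (Eventually.of_forall fun _ => norm_inner_le_norm _ _)

section LinearQuadratic

open ContinuousLinearMap (adjoint)

/-- The data of a linear-quadratic estimation problem with state equation `x' = A x + B v` and
output `C x`. The weights `W`, `Rinv = R⁻¹` and `Q` belong to the initial error, the disturbance and
the output error. -/
structure LQProblem (H U Z : Type*) [NormedAddCommGroup H] [InnerProductSpace ℝ H]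
    [NormedAddCommGroup U] [InnerProductSpace ℝ U]
    [NormedAddCommGroup Z] [InnerProductSpace ℝ Z] where
  A : H →L[ℝ] H
  B : U →L[ℝ] H
  C : H →L[ℝ] Z
  W : H →L[ℝ] H
  R : U →L[ℝ] U
  Rinv : U →L[ℝ] U
  Q : Z →L[ℝ] Z
  W_isPositive : W.IsPositive
  inner_W_pos : ∀ h, h ≠ 0 → 0 < inner ℝ h (W h)
  Rinv_R : ∀ u, Rinv (R u) = u
  Rinv_isPositive : Rinv.IsPositive
  Q_isPositive : Q.IsPositive

namespace LQProblem

variable {H U Z : Type*} [NormedAddCommGroup H] [InnerProductSpace ℝ H]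
  [NormedAddCommGroup U] [InnerProductSpace ℝ U] [NormedAddCommGroup Z] [InnerProductSpace ℝ Z]
  (S : LQProblem H U Z) {x₀ : H} {y : ℝ → Z} {t T : ℝ} {x δ : ℝ → H} {v w : ℝ → U}

/-- The running cost of the disturbance `v` and the output error `e`. -/
def running (e : Z) (v : U) : ℝ := inner ℝ v (S.Rinv v) + inner ℝ e (S.Q e)

/-- The cost on `[0, t]` of the state `x` and the disturbance `v`, for the initial guess `x₀` and
the observation `y`. -/
def cost (x₀ : H) (y : ℝ → Z) (t : ℝ) (x : ℝ → H) (v : ℝ → U) : ℝ :=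
  inner ℝ (x 0 - x₀) (S.W (x 0 - x₀)) + ∫ s in (0 : ℝ)..t, S.running (y s - S.C (x s)) (v s)

/-- `(x, v)` solves the state equation on `[0, t]` with a square integrable disturbance `v`. -/
structure IsTrajectory (t : ℝ) (x : ℝ → H) (v : ℝ → U) : Prop where
  isPrimitive : IsPrimitive 0 t x fun s => S.A (x s) + S.B (v s)
  memLp : MemLp v 2 (volume.restrict (Ioo 0 t))

theorem running_nonneg (e : Z) (v : U) : 0 ≤ S.running e v :=
  add_nonneg (S.Rinv_isPositive.inner_nonneg_right v) (S.Q_isPositive.inner_nonneg_right e)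

theorem running_sub_add (e e' : Z) (v w : U) :
    S.running (e - e') (v + w) =
      S.running e v + 2 * (inner ℝ (S.Rinv v) w - inner ℝ (S.Q e) e') + S.running e' w := by
  have hR : inner ℝ v (S.Rinv w) = inner ℝ (S.Rinv v) w :=
    (S.Rinv_isPositive.inner_left_eq_inner_right v w).symm
  have hQ : inner ℝ e (S.Q e') = inner ℝ (S.Q e) e' :=
    (S.Q_isPositive.inner_left_eq_inner_right e e').symm
  simp only [running, map_add, map_sub, inner_add_left, inner_add_right, inner_sub_left,
    inner_sub_right, hR, hQ, real_inner_comm (S.Rinv v) w, real_inner_comm (S.Q e) e']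
  ring

theorem integrable_running {μ : Measure ℝ} {e : ℝ → Z} (he : MemLp e 2 μ) (hv : MemLp v 2 μ) :
    Integrable (fun s => S.running (e s) (v s)) μ :=
  (integrable_inner_of_memLp hv (S.Rinv.comp_memLp' hv)).add
    (integrable_inner_of_memLp he (S.Q.comp_memLp' he))

theorem inner_W_le_cost (ht : 0 ≤ t) :
    inner ℝ (x 0 - x₀) (S.W (x 0 - x₀)) ≤ S.cost x₀ y t x v :=
  le_add_of_nonneg_right (intervalIntegral.integral_nonneg ht fun _ _ => S.running_nonneg _ _)

theorem cost_nonneg (ht : 0 ≤ t) : 0 ≤ S.cost x₀ y t x v :=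
  (S.W_isPositive.inner_nonneg_right _).trans (S.inner_W_le_cost ht)

theorem cost_neg : S.cost 0 0 t (-x) (-v) = S.cost 0 0 t x v := by
  simp [cost, running]

theorem cost_add (ht : 0 ≤ t) (hy : MemLp y 2 (volume.restrict (Ioo 0 t)))
    (hx : ContinuousOn x (Icc 0 t)) (hv : MemLp v 2 (volume.restrict (Ioo 0 t)))
    (hδ : ContinuousOn δ (Icc 0 t)) (hw : MemLp w 2 (volume.restrict (Ioo 0 t))) :
    S.cost x₀ y t (x + δ) (v + w) = S.cost x₀ y t x v +
      2 * (inner ℝ (S.W (x 0 - x₀)) (δ 0) + ∫ s in (0 : ℝ)..t,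
        (inner ℝ (S.Rinv (v s)) (w s) - inner ℝ (S.Q (y s - S.C (x s))) (S.C (δ s)))) +
      S.cost 0 0 t δ w := by
  have h0 : (0 : ℝ) ∈ Icc 0 t := ⟨le_rfl, ht⟩
  have htt : t ∈ Icc 0 t := ⟨ht, le_rfl⟩
  have he : MemLp (fun s => y s - S.C (x s)) 2 (volume.restrict (Ioo 0 t)) :=
    hy.sub (memLp_of_continuousOn_Icc (S.C.continuous.comp_continuousOn hx))
  have he' : MemLp (fun s => S.C (δ s)) 2 (volume.restrict (Ioo 0 t)) :=
    memLp_of_continuousOn_Icc (S.C.continuous.comp_continuousOn hδ)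
  have hrun : ∀ s, S.running (y s - S.C ((x + δ) s)) ((v + w) s) =
      S.running (y s - S.C (x s)) (v s) +
        2 * (inner ℝ (S.Rinv (v s)) (w s) - inner ℝ (S.Q (y s - S.C (x s))) (S.C (δ s))) +
      S.running (S.C (δ s)) (w s) := fun s => by
    rw [Pi.add_apply, Pi.add_apply, map_add, ← sub_sub, S.running_sub_add]
  have hcross : IntervalIntegrable (fun s => inner ℝ (S.Rinv (v s)) (w s) -
      inner ℝ (S.Q (y s - S.C (x s))) (S.C (δ s))) volume 0 t :=
    intervalIntegrable_of_mem_Icc ((integrable_inner_of_memLp (S.Rinv.comp_memLp' hv) hw).sub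
      (integrable_inner_of_memLp (S.Q.comp_memLp' he) he')) h0 htt
  have hrun₁ := intervalIntegrable_of_mem_Icc (S.integrable_running he hv) h0 htt
  have hrun₂ := intervalIntegrable_of_mem_Icc (S.integrable_running he' hw) h0 htt
  have hW : inner ℝ (x 0 - x₀) (S.W (δ 0)) = inner ℝ (S.W (x 0 - x₀)) (δ 0) :=
    (S.W_isPositive.inner_left_eq_inner_right _ _).symm
  have hneg : ∀ s, S.running ((0 : ℝ → Z) s - S.C (δ s)) (w s) = S.running (S.C (δ s)) (w s) := by
    simp [running]
  simp only [cost, hrun, hneg, sub_zero]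
  rw [intervalIntegral.integral_add (hrun₁.add (hcross.const_mul 2)) hrun₂,
    intervalIntegral.integral_add hrun₁ (hcross.const_mul 2), intervalIntegral.integral_const_mul,
    Pi.add_apply, add_sub_right_comm, map_add, inner_add_left, inner_add_right, inner_add_right, hW,
    real_inner_comm (S.W (x 0 - x₀)) (δ 0)]
  ring

theorem IsTrajectory.sub [CompleteSpace H] {S : LQProblem H U Z} (h : S.IsTrajectory t x v)
    (h' : S.IsTrajectory t δ w) : S.IsTrajectory t (x - δ) (v - w) where
  isPrimitive := (h.isPrimitive.sub h'.isPrimitive).congr_deriv fun s => by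
    simp only [Pi.sub_apply, map_sub]
    abel
  memLp := h.memLp.sub h'.memLp

section Extremal

variable [CompleteSpace H] [CompleteSpace U] [CompleteSpace Z]

/-- The Hamiltonian matrix of the problem, acting on pairs of a state and a costate. -/
def ham : (H × H) →L[ℝ] (H × H) :=
  (S.A ∘L .fst ℝ H H + (S.B ∘L S.R ∘L adjoint S.B) ∘L .snd ℝ H H).prod
    ((adjoint S.C ∘L S.Q ∘L S.C) ∘L .fst ℝ H H - adjoint S.A ∘L .snd ℝ H H)

/-- The inhomogeneity of the Hamiltonian system. -/
def source (y : ℝ → Z) (t : ℝ) : H × H := (0, -adjoint S.C (S.Q (y t)))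

/-- The disturbance that belongs to the pair `z` of a state and a costate. -/
def control (z : ℝ → H × H) (t : ℝ) : U := S.R (adjoint S.B (z t).2)

/-- `z` is a pair of a state and a costate that solves the Hamiltonian system on `[0, T]` and the
transversality condition at time `0`. -/
structure IsExtremal (x₀ : H) (y : ℝ → Z) (T : ℝ) (z : ℝ → H × H) : Prop where
  isPrimitive : IsPrimitive 0 T z fun t => S.ham (z t) + S.source y t
  costate_zero : (z 0).2 = S.W ((z 0).1 - x₀)

namespace IsExtremal

variable {S} {z z' : ℝ → H × H}

theorem add (h : S.IsExtremal x₀ y T z) (h' : S.IsExtremal 0 0 T z') :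
    S.IsExtremal x₀ y T (z + z') where
  isPrimitive := (h.isPrimitive.add h'.isPrimitive).congr_deriv fun t => by
    simp only [source, Pi.add_apply, Pi.zero_apply, map_add, map_zero, neg_zero,
      Prod.mk_zero_zero, add_zero]
    abel
  costate_zero := by
    rw [Pi.add_apply, Prod.snd_add, h.costate_zero, h'.costate_zero, ← map_add, Prod.fst_add,
      sub_zero, add_sub_right_comm]

theorem continuousOn_control (h : S.IsExtremal x₀ y T z) :
    ContinuousOn (S.control z) (Icc 0 T) :=
  (S.R ∘L adjoint S.B ∘L .snd ℝ H H).continuous.comp_continuousOn h.isPrimitive.continuousOn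

theorem isTrajectory (h : S.IsExtremal x₀ y T z) :
    S.IsTrajectory T (fun t => (z t).1) (S.control z) where
  isPrimitive := by
    simpa [ham, source, control] using h.isPrimitive.clm (.fst ℝ H H)
  memLp := memLp_of_continuousOn_Icc h.continuousOn_control

theorem isPrimitive_costate (h : S.IsExtremal x₀ y T z) :
    IsPrimitive 0 T (fun t => (z t).2)
      fun t => -adjoint S.A (z t).2 - adjoint S.C (S.Q (y t - S.C (z t).1)) := by
  refine (h.isPrimitive.clm (.snd ℝ H H)).congr_deriv fun t => ?_
  simp only [ham, source, map_add, map_sub, ContinuousLinearMap.coe_snd',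
    ContinuousLinearMap.prod_apply, sub_apply, ContinuousLinearMap.comp_apply,
    ContinuousLinearMap.coe_fst']
  abel

theorem integral_cross_eq (h : S.IsExtremal x₀ y t z) (ht : 0 ≤ t) (hδ : S.IsTrajectory t δ w) :
    ∫ s in (0 : ℝ)..t, (inner ℝ (S.Rinv (S.control z s)) (w s) -
        inner ℝ (S.Q (y s - S.C (z s).1)) (S.C (δ s))) =
      inner ℝ (z t).2 (δ t) - inner ℝ (z 0).2 (δ 0) := by
  rw [← (h.isPrimitive_costate.inner hδ.isPrimitive).integral_eq_sub ⟨le_rfl, ht⟩ ⟨ht, le_rfl⟩]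
  congr 1 with s
  simp only [control, S.Rinv_R, inner_add_right, inner_sub_left, inner_neg_left,
    ContinuousLinearMap.adjoint_inner_left]
  ring

theorem cost_add (h : S.IsExtremal x₀ y t z) (ht : 0 ≤ t)
    (hy : MemLp y 2 (volume.restrict (Ioo 0 t))) (hδ : S.IsTrajectory t δ w) :
    S.cost x₀ y t ((fun s => (z s).1) + δ) (S.control z + w) =
      S.cost x₀ y t (fun s => (z s).1) (S.control z) + 2 * inner ℝ (z t).2 (δ t) +
        S.cost 0 0 t δ w := by
  rw [S.cost_add ht hy h.isTrajectory.isPrimitive.continuousOn h.isTrajectory.memLp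
    hδ.isPrimitive.continuousOn hδ.memLp, h.integral_cross_eq ht hδ, h.costate_zero,
    add_sub_cancel]

theorem cost_le (h : S.IsExtremal x₀ y t z) (ht : 0 ≤ t)
    (hy : MemLp y 2 (volume.restrict (Ioo 0 t))) (hx : S.IsTrajectory t x v)
    (hxt : x t = (z t).1) :
    S.cost x₀ y t (fun s => (z s).1) (S.control z) ≤ S.cost x₀ y t x v := by
  have hcost := h.cost_add ht hy (hx.sub h.isTrajectory)
  rw [add_sub_cancel, add_sub_cancel, Pi.sub_apply, hxt, sub_self, inner_zero_right, mul_zero,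
    add_zero] at hcost
  exact hcost ▸ le_add_of_nonneg_right (S.cost_nonneg ht)

theorem cost_eq_inner (h : S.IsExtremal 0 0 t z) (ht : 0 ≤ t) :
    S.cost 0 0 t (fun s => (z s).1) (S.control z) = inner ℝ (z t).2 (z t).1 := by
  have hx := h.isTrajectory
  have hneg : S.IsTrajectory t (-fun s => (z s).1) (-S.control z) := by
    simpa using (hx.sub hx).sub hx
  have hcost := h.cost_add ht MemLp.zero hneg
  rw [add_neg_cancel, add_neg_cancel, S.cost_neg, Pi.neg_apply, inner_neg_right] at hcost
  have hzero : S.cost 0 0 t 0 0 = 0 := by simp [cost, running]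
  linarith

theorem inner_W_le (h : S.IsExtremal 0 0 t z) (ht : 0 ≤ t) :
    inner ℝ (z 0).1 (S.W (z 0).1) ≤ inner ℝ (z t).2 (z t).1 := by
  simpa only [h.cost_eq_inner ht, sub_zero] using
    S.inner_W_le_cost (x₀ := 0) (y := 0) (x := fun s => (z s).1) (v := S.control z) ht

end IsExtremal

/-- The solution of the homogeneous Hamiltonian system with initial values `(η, W η)`, as a function
of `η`. -/
def fund (t : ℝ) : H →L[ℝ] (H × H) :=
  linearFlow S.ham t ∘L (ContinuousLinearMap.id ℝ H).prod S.W

/-- The extremal that starts at the initial guess `x₀`. -/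
def nominal (x₀ : H) (y : ℝ → Z) : ℝ → H × H := linearSolution S.ham (x₀, 0) (S.source y)

theorem fund_zero (η : H) : S.fund 0 η = (η, S.W η) := by
  rw [fund, linearFlow_zero]
  rfl

theorem isPrimitive_fund : IsPrimitive 0 T S.fund fun t => S.ham ∘L S.fund t :=
  (isPrimitive_linearFlow S.ham T).clm
    ((ContinuousLinearMap.compL ℝ H (H × H) (H × H)).flip ((ContinuousLinearMap.id ℝ H).prod S.W))

theorem isExtremal_fund (η : H) : S.IsExtremal 0 0 T fun t => S.fund t η where
  isPrimitive :=
    (S.isPrimitive_fund.clm (ContinuousLinearMap.apply ℝ (H × H) η)).congr_deriv fun t => by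
      simp [source]
  costate_zero := by rw [fund_zero, sub_zero]

theorem isExtremal_nominal (hy : IntegrableOn y (Ioo 0 T)) :
    S.IsExtremal x₀ y T (S.nominal x₀ y) where
  isPrimitive := isPrimitive_linearSolution S.ham (x₀, 0) <|
    (ContinuousLinearMap.inr ℝ H H ∘L (-(adjoint S.C ∘L S.Q))).integrable_comp hy
  costate_zero := by rw [nominal, linearSolution_zero, sub_self, map_zero]

end Extremal

section Riccati

variable [FiniteDimensional ℝ H] [CompleteSpace U] [CompleteSpace Z]

theorem fst_fund_injective (ht : 0 ≤ t) : Function.Injective (.fst ℝ H H ∘L S.fund t) := by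
  refine (injective_iff_map_eq_zero _).2 fun η hη => by_contra fun hne => ?_
  have hle := (S.isExtremal_fund (T := t) η).inner_W_le ht
  have hη' : (S.fund t η).1 = 0 := hη
  rw [fund_zero, hη', inner_zero_right] at hle
  exact hle.not_gt (S.inner_W_pos η hne)

/-- The initial value `η` for which the state `(fund t η).1` takes a given value at time `t`. -/
def fundInv (t : ℝ) : H →L[ℝ] H := (.fst ℝ H H ∘L S.fund t).inverse

/-- The solution of the Riccati equation of the problem: it maps the state of a homogeneous
extremal at time `t` to its costate. -/
def riccati (t : ℝ) : H →L[ℝ] H := .snd ℝ H H ∘L S.fund t ∘L S.fundInv t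

theorem isInvertible_fst_fund (ht : 0 ≤ t) : (.fst ℝ H H ∘L S.fund t).IsInvertible :=
  ⟨(LinearEquiv.ofInjectiveEndo _ (S.fst_fund_injective ht)).toContinuousLinearEquiv, rfl⟩

theorem fund_fundInv (ht : 0 ≤ t) (h : H) : S.fund t (S.fundInv t h) = (h, S.riccati t h) :=
  Prod.ext ((S.isInvertible_fst_fund ht).self_apply_inverse h) rfl

theorem exists_isPrimitive_riccati (T : ℝ) : ∃ P', IsPrimitive 0 T S.riccati P' := by
  have hfund := S.isPrimitive_fund (T := T)
  have hfst := hfund.clm (ContinuousLinearMap.compL ℝ H (H × H) H (.fst ℝ H H))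
  have hsnd := hfund.clm (ContinuousLinearMap.compL ℝ H (H × H) H (.snd ℝ H H))
  have hinv := hfst.comp_contDiffAt fun t ht =>
    (S.isInvertible_fst_fund ht.1).contDiffAt_map_inverse
  exact ⟨_, hsnd.bilin (ContinuousLinearMap.compL ℝ H H H) hinv⟩

theorem inner_riccati_pos (ht : 0 ≤ t) {h : H} (hh : h ≠ 0) : 0 < inner ℝ h (S.riccati t h) := by
  have hη : S.fundInv t h ≠ 0 := fun h0 => hh <| by
    simpa [h0] using (congrArg Prod.fst (S.fund_fundInv ht h)).symm
  have hle := (S.isExtremal_fund (T := t) (S.fundInv t h)).inner_W_le ht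
  rw [fund_zero, S.fund_fundInv ht, real_inner_comm h] at hle
  exact (S.inner_W_pos _ hη).trans_le hle

end Riccati

end LQProblem

end LinearQuadratic

theorem exists_coercive_of_isCompact {α H : Type*} [TopologicalSpace α] [NormedAddCommGroup H]
    [InnerProductSpace ℝ H] [FiniteDimensional ℝ H] {K : Set α} {P : α → H →L[ℝ] H}
    (hK : IsCompact K) (hP : ContinuousOn P K)
    (hpos : ∀ a ∈ K, ∀ h, h ≠ 0 → 0 < inner ℝ h (P a h)) :
    ∃ μ > 0, ∀ a ∈ K, ∀ h, μ * ‖h‖ ^ 2 ≤ inner ℝ h (P a h) := by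
  have : ProperSpace H := FiniteDimensional.proper ℝ H
  have hcont : ContinuousOn (fun p : α × H => inner ℝ p.2 (P p.1 p.2))
      (K ×ˢ Metric.sphere (0 : H) 1) :=
    continuousOn_snd.inner ((hP.comp continuousOn_fst fun p hp => hp.1).clm_apply continuousOn_snd)
  obtain ⟨μ, hμ, hle⟩ := (hK.prod (isCompact_sphere 0 1)).exists_forall_le' hcont
    fun p hp => hpos p.1 hp.1 p.2 (ne_zero_of_mem_unit_sphere ⟨p.2, hp.2⟩)
  refine ⟨μ, hμ, fun a ha h => ?_⟩
  rcases eq_or_ne h 0 with rfl | hh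
  · simp
  have hn : ‖h‖ ≠ 0 := norm_ne_zero_iff.2 hh
  have hunit := hle (a, ‖h‖⁻¹ • h) ⟨ha, by
    rw [mem_sphere_zero_iff_norm, norm_smul, norm_inv, norm_norm, inv_mul_cancel₀ hn]⟩
  simp only [map_smul, real_inner_smul_left, real_inner_smul_right] at hunit
  calc μ * ‖h‖ ^ 2 ≤ (‖h‖⁻¹ * (‖h‖⁻¹ * inner ℝ h (P a h))) * ‖h‖ ^ 2 := by gcongr
    _ = inner ℝ h (P a h) := by field_simp

section QuadraticValue

variable {H U Z : Type*} [NormedAddCommGroup H] [InnerProductSpace ℝ H]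
  [NormedAddCommGroup U] [InnerProductSpace ℝ U] [NormedAddCommGroup Z] [InnerProductSpace ℝ Z]

/-- The coefficients `(P, (p, q), c)` of a quadratic function, expanded at the point `p`. -/
abbrev QuadCoeff (H : Type*) [NormedAddCommGroup H] [InnerProductSpace ℝ H] : Type _ :=
  (H →L[ℝ] H) × (H × H) × ℝ

/-- The quadratic function with coefficients `(P, (p, q), c)`. -/
def quadEval (a : QuadCoeff H) (ξ : H) : ℝ :=
  inner ℝ (ξ - a.2.1.1) (a.1 (ξ - a.2.1.1)) + 2 * inner ℝ a.2.1.2 (ξ - a.2.1.1) + a.2.2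

theorem contDiff_quadEval {N : ℕ∞ω} : ContDiff ℝ N fun p : QuadCoeff H × H => quadEval p.1 p.2 := by
  have hξ : ContDiff ℝ N fun p : QuadCoeff H × H => p.2 - p.1.2.1.1 := by fun_prop
  have hP : ContDiff ℝ N fun p : QuadCoeff H × H => p.1.1 := by fun_prop
  have hq : ContDiff ℝ N fun p : QuadCoeff H × H => p.1.2.1.2 := by fun_prop
  have hc : ContDiff ℝ N fun p : QuadCoeff H × H => p.1.2.2 := by fun_prop
  exact ((hξ.inner ℝ (hP.clm_apply hξ)).add (contDiff_const.mul (hq.inner ℝ hξ))).add hc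

namespace LQProblem

variable (S : LQProblem H U Z) {x₀ : H} {y : ℝ → Z} {t T : ℝ} [FiniteDimensional ℝ H]
  [CompleteSpace U] [CompleteSpace Z]

/-- The coefficients of the minimal cost on `[0, t]` as a function of the state at time `t`. -/
def coeff (x₀ : H) (y : ℝ → Z) (t : ℝ) : QuadCoeff H :=
  (S.riccati t, S.nominal x₀ y t,
    S.cost x₀ y t (fun s => (S.nominal x₀ y s).1) (S.control (S.nominal x₀ y)))

theorem exists_isPrimitive_coeff (x₀ : H) (hy : MemLp y 2 (volume.restrict (Ioo 0 T))) :
    ∃ c', IsPrimitive 0 T (S.coeff x₀ y) c' := by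
  have hnom := S.isExtremal_nominal (x₀ := x₀) (hy.integrable one_le_two)
  have herr : MemLp (fun s => y s - S.C (S.nominal x₀ y s).1) 2 (volume.restrict (Ioo 0 T)) :=
    hy.sub (memLp_of_continuousOn_Icc (S.C.continuous.comp_continuousOn
      hnom.isTrajectory.isPrimitive.continuousOn))
  obtain ⟨P', hP⟩ := S.exists_isPrimitive_riccati T
  exact ⟨_, hP.prodMk (hnom.isPrimitive.prodMk
    (.of_integrableOn (S.integrable_running herr hnom.isTrajectory.memLp) _))⟩

theorem isLeast_cost (ht : 0 ≤ t) (hy : MemLp y 2 (volume.restrict (Ioo 0 t))) (ξ : H) :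
    IsLeast {c | ∃ x v, S.IsTrajectory t x v ∧ x t = ξ ∧ c = S.cost x₀ y t x v}
      (quadEval (S.coeff x₀ y t) ξ) := by
  have hnom := S.isExtremal_nominal (x₀ := x₀) (hy.integrable one_le_two)
  have hfund := S.isExtremal_fund (T := t) (S.fundInv t (ξ - (S.nominal x₀ y t).1))
  have hend := S.fund_fundInv ht (ξ - (S.nominal x₀ y t).1)
  set z := S.nominal x₀ y + fun s => S.fund s (S.fundInv t (ξ - (S.nominal x₀ y t).1))
  have hz : S.IsExtremal x₀ y t z := hnom.add hfund
  have hzt : (z t).1 = ξ := by simp only [z, Pi.add_apply, hend, Prod.fst_add, add_sub_cancel]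
  have hcost : S.cost x₀ y t (fun s => (z s).1) (S.control z) = quadEval (S.coeff x₀ y t) ξ := by
    have hctrl : S.control z = S.control (S.nominal x₀ y) +
        S.control fun s => S.fund s (S.fundInv t (ξ - (S.nominal x₀ y t).1)) :=
      funext fun s => by simp only [control, z, Pi.add_apply, Prod.snd_add, map_add]
    have hadd := hnom.cost_add ht hy hfund.isTrajectory
    rw [← hctrl, hfund.cost_eq_inner ht, hend] at hadd
    refine Eq.trans hadd ?_
    simp only [quadEval, coeff, real_inner_comm (ξ - (S.nominal x₀ y t).1)]
    ring
  exact ⟨⟨_, _, hz.isTrajectory, hzt, hcost.symm⟩, fun c ⟨x, v, hx, hxt, hc⟩ =>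
    hcost ▸ hc ▸ hz.cost_le ht hy hx (hxt.trans hzt.symm)⟩

end LQProblem

end QuadraticValue

section StrongConvexity

variable {V : Type*} [NormedAddCommGroup V] [NormedSpace ℝ V] {m : ℝ} {φ : V → ℝ}

theorem le_of_strongConvexOn_of_isMin (hφ : StrongConvexOn univ m φ) {x : V}
    (hx : ∀ z, φ x ≤ φ z) (z : V) : m / 4 * ‖z - x‖ ^ 2 ≤ φ z - φ x := by
  have hhalf : (0 : ℝ) ≤ 2⁻¹ := by norm_num
  have hmid := hφ.2 (mem_univ z) (mem_univ x) hhalf hhalf (by norm_num)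
  have hle := hx ((2⁻¹ : ℝ) • z + (2⁻¹ : ℝ) • x)
  simp only [smul_eq_mul] at hmid
  linarith

theorem add_fderiv_le_of_strongConvexOn (hφ : StrongConvexOn univ m φ) {x : V}
    (hd : DifferentiableAt ℝ φ x) (z : V) :
    φ x + fderiv ℝ φ x (z - x) + m / 2 * ‖z - x‖ ^ 2 ≤ φ z := by
  have hline : HasDerivAt (fun s : ℝ => φ (x + s • (z - x))) (fderiv ℝ φ x (z - x)) 0 :=
    hd.hasFDerivAt.hasLineDerivAt (z - x)
  have hlim : Tendsto (fun s : ℝ => φ z - φ x - (1 - s) * (m / 2 * ‖z - x‖ ^ 2)) (𝓝[>] 0)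
      (𝓝 (φ z - φ x - (1 - 0) * (m / 2 * ‖z - x‖ ^ 2))) :=
    (Continuous.tendsto (by fun_prop) _).mono_left nhdsWithin_le_nhds
  have hle := le_of_tendsto_of_tendsto hline.tendsto_slope_zero_right hlim <| by
    filter_upwards [Ioo_mem_nhdsGT (zero_lt_one' ℝ)] with s hs
    have hconv := hφ.2 (mem_univ z) (mem_univ x) hs.1.le (sub_nonneg.2 hs.2.le) (by ring)
    have hpt : s • z + (1 - s) • x = x + s • (z - x) := by module
    simp only [hpt, smul_eq_mul] at hconv
    simp only [zero_add, zero_smul, add_zero, smul_eq_mul]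
    rw [inv_mul_le_iff₀ hs.1]
    linarith
  linarith

theorem le_fderiv_sub_of_strongConvexOn (hφ : StrongConvexOn univ m φ) (hd : Differentiable ℝ φ)
    (x h : V) : m * ‖h‖ ^ 2 ≤ (fderiv ℝ φ (x + h) - fderiv ℝ φ x) h := by
  have hx := add_fderiv_le_of_strongConvexOn hφ (hd x) (x + h)
  have hxh := add_fderiv_le_of_strongConvexOn hφ (hd (x + h)) x
  simp only [add_sub_cancel_left, sub_add_cancel_left, map_neg, norm_neg] at hx hxh
  rw [sub_apply]
  linarith

theorem hasDerivAt_apply_line {G : V → V →L[ℝ] ℝ} {G' : V →L[ℝ] V →L[ℝ] ℝ} {x h : V} {s : ℝ}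
    (hG : HasFDerivAt G G' (x + s • h)) :
    HasDerivAt (fun s : ℝ => G (x + s • h) h) (G' h h) s := by
  have hline : HasDerivAt (fun s : ℝ => x + s • h) h s := by
    simpa using ((hasDerivAt_id s).smul_const h).const_add x
  exact ((ContinuousLinearMap.apply ℝ ℝ h).hasFDerivAt.comp _ hG).comp_hasDerivAt s hline

theorem le_hessian_of_strongConvexOn (hφ : StrongConvexOn univ m φ) (hd : ContDiff ℝ 2 φ)
    (x h : V) : m * ‖h‖ ^ 2 ≤ fderiv ℝ (fderiv ℝ φ) x h h := by
  have hderiv : HasDerivAt (fun s : ℝ => fderiv ℝ φ (x + s • h) h)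
      (fderiv ℝ (fderiv ℝ φ) x h h) 0 := by
    have hD := (hd.fderiv_right (m := 1) le_rfl).differentiable one_ne_zero
    simpa using hasDerivAt_apply_line (hD (x + (0 : ℝ) • h)).hasFDerivAt
  refine ge_of_tendsto hderiv.tendsto_slope_zero_right ?_
  filter_upwards [self_mem_nhdsWithin] with s (hs : 0 < s)
  have hmono := le_fderiv_sub_of_strongConvexOn hφ (hd.differentiable two_ne_zero) x (s • h)
  simp only [norm_smul, Real.norm_of_nonneg hs.le, map_smul, sub_apply, smul_eq_mul] at hmono
  simp only [zero_add, zero_smul, add_zero, smul_eq_mul]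
  rw [le_inv_mul_iff₀ hs]
  nlinarith

theorem tendsto_cocompact_of_strongConvexOn [FiniteDimensional ℝ V] (hφ : StrongConvexOn univ m φ)
    (hm : 0 < m) (hd : Differentiable ℝ φ) : Tendsto φ (cocompact V) atTop := by
  have : ProperSpace V := FiniteDimensional.proper ℝ V
  have hlower (ξ : V) : φ 0 + ‖ξ‖ * (m / 2 * ‖ξ‖ + -‖fderiv ℝ φ 0‖) ≤ φ ξ := by
    have hξ := add_fderiv_le_of_strongConvexOn hφ (hd 0) ξ
    have hop := (abs_le.1 ((fderiv ℝ φ 0).le_opNorm ξ)).1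
    rw [sub_zero] at hξ
    linarith
  have hnorm : Tendsto (fun ξ : V => ‖ξ‖) (cocompact V) atTop := tendsto_norm_cocompact_atTop
  exact tendsto_atTop_mono hlower <| tendsto_atTop_add_const_left _ _ <| hnorm.atTop_mul_atTop₀ <|
    tendsto_atTop_add_const_right _ _ (hnorm.const_mul_atTop (half_pos hm))

end StrongConvexity

section Risk

variable {ι : Type*} [Fintype ι] [Nonempty ι] {θ : ℝ}

theorem le_worstCase (X : ι → ℝ) (k : ι) : X k ≤ worstCase X :=
  Finset.le_sup' X (Finset.mem_univ k)

theorem worstCase_le {X : ι → ℝ} {c : ℝ} (h : ∀ k, X k ≤ c) : worstCase X ≤ c :=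
  Finset.sup'_le _ _ fun k _ => h k

theorem card_pos_real : 0 < (Fintype.card ι : ℝ) := Nat.cast_pos.2 Fintype.card_pos

theorem expectation_exp_pos (θ : ℝ) (X : ι → ℝ) : 0 < expectation fun k => Real.exp (θ * X k) :=
  mul_pos (one_div_pos.2 card_pos_real) <|
    Finset.sum_pos (fun _ _ => Real.exp_pos _) Finset.univ_nonempty

theorem expectation_le_expectation_iff {X Y : ι → ℝ} :
    expectation X ≤ expectation Y ↔ ∑ k, X k ≤ ∑ k, Y k :=
  mul_le_mul_iff_right₀ (one_div_pos.2 card_pos_real)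

theorem expectation_le {X : ι → ℝ} {c : ℝ} (h : ∀ k, X k ≤ c) : expectation X ≤ c := by
  rw [expectation, one_div, inv_mul_le_iff₀ card_pos_real]
  simpa using Finset.sum_le_sum fun k (_ : k ∈ Finset.univ) => h k

theorem entropicRisk_le_entropicRisk_iff (hθ : 0 < θ) {X Y : ι → ℝ} :
    entropicRisk θ X ≤ entropicRisk θ Y ↔
      ∑ k, Real.exp (θ * X k) ≤ ∑ k, Real.exp (θ * Y k) := by
  rw [entropicRisk, entropicRisk, mul_le_mul_iff_right₀ (one_div_pos.2 hθ),
    Real.log_le_log_iff (expectation_exp_pos θ X) (expectation_exp_pos θ Y),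
    expectation_le_expectation_iff]

theorem entropicRisk_le_worstCase (hθ : 0 < θ) (X : ι → ℝ) : entropicRisk θ X ≤ worstCase X := by
  rw [entropicRisk, one_div, inv_mul_le_iff₀ hθ, Real.log_le_iff_le_exp (expectation_exp_pos θ X)]
  exact expectation_le fun k => by gcongr; exact le_worstCase X k

theorem worstCase_le_entropicRisk (hθ : 0 < θ) (X : ι → ℝ) :
    worstCase X ≤ entropicRisk θ X + Real.log (Fintype.card ι) / θ := by
  refine worstCase_le fun k => ?_
  have hlog : θ * X k - Real.log (Fintype.card ι) ≤
      Real.log (expectation fun k => Real.exp (θ * X k)) := by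
    rw [Real.le_log_iff_exp_le (expectation_exp_pos θ X), Real.exp_sub, Real.exp_log card_pos_real,
      expectation, one_div, ← div_eq_inv_mul]
    gcongr
    exact Finset.single_le_sum (f := fun k => Real.exp (θ * X k))
      (fun _ _ => (Real.exp_pos _).le) (Finset.mem_univ k)
  rw [entropicRisk, one_div, ← div_eq_inv_mul, ← add_div, le_div_iff₀ hθ]
  linarith

section Functions

variable {V : Type*} [NormedAddCommGroup V] [NormedSpace ℝ V] {m : ℝ} {Φ : ι → V → ℝ}

theorem strongConvexOn_worstCase (hΦ : ∀ k, StrongConvexOn univ m (Φ k)) :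
    StrongConvexOn univ m fun x => worstCase fun k => Φ k x := by
  refine ⟨convex_univ, fun x _ y _ a b ha hb hab => worstCase_le fun k => ?_⟩
  refine ((hΦ k).2 (mem_univ x) (mem_univ y) ha hb hab).trans ?_
  have hx := le_worstCase (fun k => Φ k x) k
  have hy := le_worstCase (fun k => Φ k y) k
  simp only [smul_eq_mul]
  gcongr

theorem strongConvexOn_expectation (hΦ : ∀ k, StrongConvexOn univ m (Φ k)) :
    StrongConvexOn univ m fun x => expectation fun k => Φ k x := by
  refine ⟨convex_univ, fun x _ y _ a b ha hb hab => ?_⟩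
  have hsum := Finset.sum_le_sum fun k (_ : k ∈ Finset.univ) =>
    (hΦ k).2 (mem_univ x) (mem_univ y) ha hb hab
  simp only [smul_eq_mul, Finset.sum_sub_distrib, Finset.sum_add_distrib, ← Finset.mul_sum,
    Finset.sum_const, Finset.card_univ, nsmul_eq_mul] at hsum
  have hcard : 0 < (Fintype.card ι : ℝ) := card_pos_real
  simp only [expectation, smul_eq_mul, one_div]
  rw [inv_mul_le_iff₀ hcard]
  refine hsum.trans_eq ?_
  field_simp

end Functions

end Risk

section Minimizers

variable {n : ℕ}

theorem argmin_le {F : E n → ℝ} (hF : Continuous F) (hc : Tendsto F (cocompact (E n)) atTop)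
    (z : E n) : F (argmin F) ≤ F z :=
  Classical.epsilon_spec (p := fun x => ∀ z, F x ≤ F z) (hF.exists_forall_le hc) z

variable {ι : Type*} [Fintype ι] [Nonempty ι] {m θ : ℝ} {Φ : ι → E n → ℝ}

theorem worstCase_argmin_le (hm : 0 < m) (hd : ∀ k, Differentiable ℝ (Φ k))
    (hΦ : ∀ k, StrongConvexOn univ m (Φ k)) (z : E n) :
    (worstCase fun k => Φ k (argmin fun x => worstCase fun k => Φ k x)) ≤
      worstCase fun k => Φ k z := by
  obtain ⟨k⟩ := ‹Nonempty ι›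
  exact argmin_le (F := fun x => worstCase fun k => Φ k x)
    (Continuous.finset_sup'_apply _ fun k _ => (hd k).continuous)
    (tendsto_atTop_mono (fun x => le_worstCase (fun k => Φ k x) k)
      (tendsto_cocompact_of_strongConvexOn (hΦ k) hm (hd k))) z

theorem expectation_argmin_le (hm : 0 < m) (hd : ∀ k, Differentiable ℝ (Φ k))
    (hΦ : ∀ k, StrongConvexOn univ m (Φ k)) (z : E n) :
    (expectation fun k => Φ k (argmin fun x => expectation fun k => Φ k x)) ≤
      expectation fun k => Φ k z := by
  have hD : Differentiable ℝ fun x => expectation fun k => Φ k x :=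
    (Differentiable.fun_sum fun k _ => hd k).const_mul _
  exact argmin_le (F := fun x => expectation fun k => Φ k x) hD.continuous
    (tendsto_cocompact_of_strongConvexOn (strongConvexOn_expectation hΦ) hm hD) z

theorem continuous_entropicRisk (θ : ℝ) (hΦ : ∀ k, Continuous (Φ k)) :
    Continuous fun x => entropicRisk θ fun k => Φ k x :=
  continuous_const.mul ((continuous_const.mul (continuous_finsetSum _ fun k _ =>
    Real.continuous_exp.comp (continuous_const.mul (hΦ k)))).log
    fun _ => (expectation_exp_pos θ _).ne')

theorem entropicRisk_argmin_le (hm : 0 < m) (hd : ∀ k, Differentiable ℝ (Φ k))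
    (hΦ : ∀ k, StrongConvexOn univ m (Φ k)) (hθ : 0 < θ) (z : E n) :
    (entropicRisk θ fun k => Φ k (argmin fun x => entropicRisk θ fun k => Φ k x)) ≤
      entropicRisk θ fun k => Φ k z := by
  obtain ⟨k⟩ := ‹Nonempty ι›
  have hlower (x : E n) :
      Φ k x + -(Real.log (Fintype.card ι) / θ) ≤ entropicRisk θ fun k => Φ k x := by
    linarith [le_worstCase (fun k => Φ k x) k, worstCase_le_entropicRisk hθ fun k => Φ k x]
  exact argmin_le (F := fun x => entropicRisk θ fun k => Φ k x)
    (continuous_entropicRisk θ fun k => (hd k).continuous)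
    (tendsto_atTop_mono hlower (tendsto_atTop_add_const_right _ _
      (tendsto_cocompact_of_strongConvexOn (hΦ k) hm (hd k)))) z

theorem norm_argmin_entropicRisk_sub_argmin_worstCase_le (hm : 0 < m)
    (hd : ∀ k, Differentiable ℝ (Φ k)) (hΦ : ∀ k, StrongConvexOn univ m (Φ k)) (hθ : 0 < θ) :
    ‖(argmin fun x => entropicRisk θ fun k => Φ k x) -
      argmin fun x => worstCase fun k => Φ k x‖ ^ 2 ≤
        4 / m * (Real.log (Fintype.card ι) / θ) := by
  set x := argmin fun x => worstCase fun k => Φ k x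
  set z := argmin fun x => entropicRisk θ fun k => Φ k x
  have hgrowth : m / 4 * ‖z - x‖ ^ 2 ≤ (worstCase fun k => Φ k z) - worstCase fun k => Φ k x :=
    le_of_strongConvexOn_of_isMin (strongConvexOn_worstCase hΦ) (worstCase_argmin_le hm hd hΦ) z
  have hgap : (worstCase fun k => Φ k z) ≤
      (worstCase fun k => Φ k x) + Real.log (Fintype.card ι) / θ :=
    calc (worstCase fun k => Φ k z)
        ≤ (entropicRisk θ fun k => Φ k z) + Real.log (Fintype.card ι) / θ :=
          worstCase_le_entropicRisk hθ _
      _ ≤ (entropicRisk θ fun k => Φ k x) + Real.log (Fintype.card ι) / θ := by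
          gcongr; exact entropicRisk_argmin_le hm hd hΦ hθ x
      _ ≤ (worstCase fun k => Φ k x) + Real.log (Fintype.card ι) / θ := by
          gcongr; exact entropicRisk_le_worstCase hθ _
  rw [div_mul_eq_mul_div, le_div_iff₀ hm]
  linarith

end Minimizers

section EntropicGradient

variable {V : Type*} [NormedAddCommGroup V] [NormedSpace ℝ V] {ι : Type*} [Fintype ι]
  {m θ : ℝ} {Φ : ι → V → ℝ}

/-- The derivative of the entropic risk of `Φ` up to the positive factor `∑ exp (θ Φ_k)`. This
normalization extends it to `θ = 0`, where it is the derivative of `∑ Φ_k`. -/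
def entropicGradient (θ : ℝ) (Φ : ι → V → ℝ) (x : V) : V →L[ℝ] ℝ :=
  ∑ k, Real.exp (θ * Φ k x) • fderiv ℝ (Φ k) x

theorem hasFDerivAt_entropicGradient (θ : ℝ) (hd : ∀ k, ContDiff ℝ 2 (Φ k)) (x : V) :
    HasFDerivAt (entropicGradient θ Φ)
      (∑ k, (Real.exp (θ * Φ k x) • fderiv ℝ (fderiv ℝ (Φ k)) x +
        (Real.exp (θ * Φ k x) • θ • fderiv ℝ (Φ k) x).smulRight (fderiv ℝ (Φ k) x))) x := by
  refine HasFDerivAt.fun_sum fun k _ => ?_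
  have hΦ := ((hd k).differentiable two_ne_zero x).hasFDerivAt
  have hDΦ := (((hd k).fderiv_right (m := 1) le_rfl).differentiable one_ne_zero x).hasFDerivAt
  exact (hΦ.const_mul θ).exp.smul hDΦ

theorem fderiv_entropicGradient_pos [Nonempty ι] (hm : 0 < m) (hd : ∀ k, ContDiff ℝ 2 (Φ k))
    (hΦ : ∀ k, StrongConvexOn univ m (Φ k)) (hθ : 0 ≤ θ) (x : V) {h : V} (hh : h ≠ 0) :
    0 < fderiv ℝ (entropicGradient θ Φ) x h h := by
  rw [(hasFDerivAt_entropicGradient θ hd x).fderiv]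
  simp only [sum_apply, add_apply, smul_apply, ContinuousLinearMap.smulRight_apply, smul_eq_mul]
  refine Finset.sum_pos (fun k _ => add_pos_of_pos_of_nonneg (mul_pos (Real.exp_pos _) ?_) ?_)
    Finset.univ_nonempty
  · have hhess := le_hessian_of_strongConvexOn (hΦ k) (hd k) x h
    have hpos : 0 < m * ‖h‖ ^ 2 := by positivity
    exact hpos.trans_le hhess
  · rw [mul_assoc, mul_assoc]
    have := mul_self_nonneg (fderiv ℝ (Φ k) x h)
    positivity

theorem eq_of_entropicGradient_eq_zero [Nonempty ι] (hm : 0 < m) (hd : ∀ k, ContDiff ℝ 2 (Φ k))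
    (hΦ : ∀ k, StrongConvexOn univ m (Φ k)) (hθ : 0 ≤ θ) {x z : V}
    (hx : entropicGradient θ Φ x = 0) (hz : entropicGradient θ Φ z = 0) : x = z := by
  by_contra hne
  have hderiv (s : ℝ) : HasDerivAt (fun s : ℝ => entropicGradient θ Φ (x + s • (z - x)) (z - x))
      (fderiv ℝ (entropicGradient θ Φ) (x + s • (z - x)) (z - x) (z - x)) s :=
    hasDerivAt_apply_line
      (hasFDerivAt_entropicGradient θ hd (x + s • (z - x))).differentiableAt.hasFDerivAt
  obtain ⟨s, _, hs⟩ := exists_hasDerivAt_eq_zero (zero_lt_one' ℝ)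
    (fun s _ => (hderiv s).continuousAt.continuousWithinAt) (by simp [hx, hz]) (fun s _ => hderiv s)
  exact (fderiv_entropicGradient_pos hm hd hΦ hθ _ (sub_ne_zero.2 (Ne.symm hne))).ne' hs

theorem isInvertible_fderiv_entropicGradient {V : Type*} [NormedAddCommGroup V]
    [InnerProductSpace ℝ V] [FiniteDimensional ℝ V] [Nonempty ι] {Φ : ι → V → ℝ} (hm : 0 < m)
    (hd : ∀ k, ContDiff ℝ 2 (Φ k)) (hΦ : ∀ k, StrongConvexOn univ m (Φ k)) (hθ : 0 ≤ θ) (x : V) :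
    (fderiv ℝ (entropicGradient θ Φ) x).IsInvertible := by
  have hinj : Function.Injective (fderiv ℝ (entropicGradient θ Φ) x : V →ₗ[ℝ] V →L[ℝ] ℝ) := by
    refine (injective_iff_map_eq_zero _).2 fun h h0 => ?_
    by_contra hh
    have hpos := fderiv_entropicGradient_pos hm hd hΦ hθ x hh
    rw [show fderiv ℝ (entropicGradient θ Φ) x h = 0 from h0] at hpos
    exact lt_irrefl 0 hpos
  have hdim : Module.finrank ℝ V = Module.finrank ℝ (V →L[ℝ] ℝ) :=
    (InnerProductSpace.toDual ℝ V).toLinearEquiv.finrank_eq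
  exact ⟨(LinearEquiv.ofInjectiveOfFinrankEq _ hinj hdim).toContinuousLinearEquiv, rfl⟩

theorem entropicGradient_argmin_entropicRisk {n : ℕ} [Nonempty ι] {Φ : ι → E n → ℝ} (hm : 0 < m)
    (hd : ∀ k, Differentiable ℝ (Φ k)) (hΦ : ∀ k, StrongConvexOn univ m (Φ k)) (hθ : 0 < θ) :
    entropicGradient θ Φ (argmin fun x => entropicRisk θ fun k => Φ k x) = 0 := by
  set z := argmin fun x => entropicRisk θ fun k => Φ k x
  have hmin : IsLocalMin (fun x => ∑ k, Real.exp (θ * Φ k x)) z :=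
    Eventually.of_forall fun x =>
      (entropicRisk_le_entropicRisk_iff hθ).1 (entropicRisk_argmin_le hm hd hΦ hθ x)
  have hder : HasFDerivAt (fun x => ∑ k, Real.exp (θ * Φ k x))
      (∑ k, Real.exp (θ * Φ k z) • θ • fderiv ℝ (Φ k) z) z :=
    HasFDerivAt.fun_sum fun k _ => ((hd k z).hasFDerivAt.const_mul θ).exp
  have hzero := hmin.hasFDerivAt_eq_zero hder
  simp only [smul_comm _ θ, ← Finset.smul_sum] at hzero
  exact (smul_eq_zero.1 hzero).resolve_left hθ.ne'

theorem entropicGradient_argmin_expectation {n : ℕ} [Nonempty ι] {Φ : ι → E n → ℝ} (hm : 0 < m)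
    (hd : ∀ k, Differentiable ℝ (Φ k)) (hΦ : ∀ k, StrongConvexOn univ m (Φ k)) :
    entropicGradient 0 Φ (argmin fun x => expectation fun k => Φ k x) = 0 := by
  set z := argmin fun x => expectation fun k => Φ k x
  have hmin : IsLocalMin (fun x => ∑ k, Φ k x) z :=
    Eventually.of_forall fun x =>
      expectation_le_expectation_iff.1 (expectation_argmin_le hm hd hΦ x)
  simpa [entropicGradient] using
    hmin.hasFDerivAt_eq_zero (HasFDerivAt.fun_sum fun k _ => (hd k z).hasFDerivAt)

end EntropicGradient

section UniformConvergence

theorem tendsto_eLpNorm_zero_of_norm_le_mul {ι α F G : Type*} [MeasurableSpace α] {μ : Measure α}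
    [NormedAddCommGroup F] [NormedAddCommGroup G] {l : Filter ι} {p : ℝ≥0∞} {w : ι → α → F}
    {g : α → G} (hg : MemLp g p μ)
    (h : ∀ ε > 0, ∀ᶠ i in l, ∀ᵐ t ∂μ, ‖w i t‖ ≤ ε * ‖g t‖) :
    Tendsto (fun i => eLpNorm (w i) p μ) l (𝓝 0) := by
  refine ENNReal.tendsto_nhds_zero.2 fun η hη => ?_
  have hlim : Tendsto (fun ε => ENNReal.ofReal ε * eLpNorm g p μ) (𝓝[>] 0) (𝓝 0) := by
    have h0 := ENNReal.Tendsto.mul_const (ENNReal.tendsto_ofReal (tendsto_id (x := 𝓝 (0 : ℝ))))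
      (Or.inr hg.eLpNorm_ne_top)
    simp only [ENNReal.ofReal_zero, zero_mul, id] at h0
    exact h0.mono_left nhdsWithin_le_nhds
  obtain ⟨ε, hεη, hε⟩ := (((ENNReal.tendsto_nhds_zero.1 hlim) η hη).and self_mem_nhdsWithin).exists
  filter_upwards [h ε hε] with i hi
  exact (eLpNorm_le_mul_eLpNorm_of_ae_le_mul hi p).trans hεη

variable {ι 𝒜 : Type*} [NormedAddCommGroup 𝒜] [NormedSpace ℝ 𝒜] {n : ℕ} {a b : ℝ} {l : Filter ι}
  {u : ι → ℝ → E n} {u₀ : ℝ → E n}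

theorem tendsto_normLp_of_tendstoUniformlyOn {p : ℝ≥0∞} (hu : TendstoUniformlyOn u u₀ l (Icc a b)) :
    Tendsto (fun i => normLp p a b (u i - u₀)) l (𝓝 0) := by
  refine tendsto_eLpNorm_zero_of_norm_le_mul (memLp_const (1 : ℝ)) fun ε hε => ?_
  filter_upwards [Metric.tendstoUniformlyOn_iff.1 hu ε hε] with i hi
  filter_upwards [ae_restrict_mem measurableSet_Ioo] with t ht
  simpa [dist_eq_norm'] using (hi t (Ioo_subset_Icc_self ht)).le

theorem tendsto_normW11_of_tendstoUniformlyOn (hab : a ≤ b) {c' : ℝ → 𝒜}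
    (hc : IntegrableOn c' (Ioo a b)) {L : ι → ℝ → 𝒜 →L[ℝ] E n} {L₀ : ℝ → 𝒜 →L[ℝ] E n}
    (hu : ∀ᶠ i in l, IsPrimitive a b (u i) fun t => L i t (c' t))
    (hu₀ : IsPrimitive a b u₀ fun t => L₀ t (c' t)) (huu₀ : TendstoUniformlyOn u u₀ l (Icc a b))
    (hLL₀ : TendstoUniformlyOn L L₀ l (Icc a b)) :
    Tendsto (fun i => normW11 a b (u i - u₀)) l (𝓝 0) := by
  have hderiv : Tendsto (fun i => normLp 1 a b fun t => L i t (c' t) - L₀ t (c' t)) l (𝓝 0) := by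
    refine tendsto_eLpNorm_zero_of_norm_le_mul (memLp_one_iff_integrable.2 hc) fun ε hε => ?_
    filter_upwards [Metric.tendstoUniformlyOn_iff.1 hLL₀ ε hε] with i hi
    filter_upwards [ae_restrict_mem measurableSet_Ioo] with t ht
    rw [← sub_apply]
    refine ContinuousLinearMap.le_of_opNorm_le _ ?_ _
    simpa [dist_eq_norm'] using (hi t (Ioo_subset_Icc_self ht)).le
  have hsum := (tendsto_normLp_of_tendstoUniformlyOn (p := 1) huu₀).add hderiv
  rw [add_zero] at hsum
  refine hsum.congr' ?_
  filter_upwards [hu] with i hi using ((hi.sub hu₀).normW11_eq hab).symm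

theorem tendstoUniformlyOn_of_continuousOn_prod {X Y F : Type*} [TopologicalSpace X]
    [TopologicalSpace Y] [UniformSpace F] {f : X → Y → F} {s : Set X} {K : Set Y} {q : X}
    (hK : IsCompact K) (hf : ContinuousOn (fun p : X × Y => f p.1 p.2) (s ×ˢ K)) (hq : q ∈ s) :
    TendstoUniformlyOn f (f q) (𝓝[s] q) K := by
  intro U hU
  obtain ⟨v, hv, hvU⟩ := hK.mem_uniformity_of_prod hf hq (UniformSpace.symm hU)
  filter_upwards [hv] with p hp using hvU p hp

end UniformConvergence

section ZeroFamily

variable {𝒜 V W : Type*} [NormedAddCommGroup 𝒜] [NormedSpace ℝ 𝒜] [NormedAddCommGroup V]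
  [NormedSpace ℝ V] [NormedAddCommGroup W] [NormedSpace ℝ W]

/-- `x θ t` is the only zero of `G ((θ, c t), ·)`, and it is nondegenerate: the implicit function
theorem applies to `G` at `((θ, c t), x θ t)`, for all `θ ∈ Θ` and `t ∈ [a, b]`. -/
structure IsZeroFamily (G : (ℝ × 𝒜) × V → W) (Θ : Set ℝ) (a b : ℝ) (c : ℝ → 𝒜)
    (x : ℝ → ℝ → V) : Prop where
  contDiff : ContDiff ℝ 1 G
  isInvertible : ∀ θ ∈ Θ, ∀ t ∈ Icc a b,
    (fderiv ℝ G ((θ, c t), x θ t) ∘L .inr ℝ (ℝ × 𝒜) V).IsInvertible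
  eq_zero_iff : ∀ θ ∈ Θ, ∀ t ∈ Icc a b, ∀ ξ, G ((θ, c t), ξ) = 0 ↔ ξ = x θ t

/-- The derivative with respect to `α` of the implicit function `ξ (θ, α)` given by
`G ((θ, α), ξ) = 0`. -/
def zeroDeriv (G : (ℝ × 𝒜) × V → W) (p : (ℝ × 𝒜) × V) : 𝒜 →L[ℝ] V :=
  (-(fderiv ℝ G p ∘L .inr ℝ (ℝ × 𝒜) V).inverse ∘L (fderiv ℝ G p ∘L .inl ℝ (ℝ × 𝒜) V)) ∘L
    .inr ℝ ℝ 𝒜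

theorem continuousAt_zeroDeriv [CompleteSpace V] {G : (ℝ × 𝒜) × V → W} (hG : ContDiff ℝ 1 G)
    {p : (ℝ × 𝒜) × V} (hp : (fderiv ℝ G p ∘L .inr ℝ (ℝ × 𝒜) V).IsInvertible) :
    ContinuousAt (zeroDeriv G) p := by
  have hD : Continuous (fderiv ℝ G) := hG.continuous_fderiv one_ne_zero
  have hinv : ContinuousAt (fun q => (fderiv ℝ G q ∘L .inr ℝ (ℝ × 𝒜) V).inverse) p :=
    ContinuousAt.comp (f := fun q => fderiv ℝ G q ∘L .inr ℝ (ℝ × 𝒜) V)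
      (hp.contDiffAt_map_inverse (n := 1)).continuousAt (hD.clm_comp continuous_const).continuousAt
  exact (hinv.neg.clm_comp (hD.clm_comp continuous_const).continuousAt).clm_comp continuousAt_const

theorem continuousOn_param {X Y : Type*} [TopologicalSpace X] [TopologicalSpace Y] {c : X → Y}
    {s : Set X} {Θ : Set ℝ} (hc : ContinuousOn c s) :
    ContinuousOn (fun p : ℝ × X => (p.1, c p.2)) (Θ ×ˢ s) :=
  continuousOn_fst.prodMk (hc.comp continuousOn_snd fun _ hp => hp.2)

namespace IsZeroFamily

variable [CompleteSpace 𝒜] [CompleteSpace V] [CompleteSpace W] {G : (ℝ × 𝒜) × V → W} {Θ : Set ℝ}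
  {a b : ℝ} {c c' : ℝ → 𝒜} {x : ℝ → ℝ → V} {θ t : ℝ}

theorem exists_implicitFunction (h : IsZeroFamily G Θ a b c x) (hc : ContinuousOn c (Icc a b))
    (hθ : θ ∈ Θ) (ht : t ∈ Icc a b) :
    ∃ ψ : ℝ × 𝒜 → V, ContinuousAt ψ (θ, c t) ∧
      HasFDerivAt (fun α => ψ (θ, α)) (zeroDeriv G ((θ, c t), x θ t)) (c t) ∧
      ∀ᶠ p in 𝓝[Θ ×ˢ Icc a b] (θ, t), x p.1 p.2 = ψ (p.1, c p.2) := by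
  have hG : ContDiffAt ℝ 1 G ((θ, c t), x θ t) := h.contDiff.contDiffAt
  have hinv := h.isInvertible θ hθ t ht
  have hψ := (hG.hasStrictFDerivAt_implicitFunction one_ne_zero hinv).hasFDerivAt
  have hzero := hG.eventually_apply_implicitFunction one_ne_zero hinv
  refine ⟨hG.implicitFunction one_ne_zero hinv, hψ.continuousAt,
    hψ.comp (c t) (hasFDerivAt_prodMk_right θ (c t)), ?_⟩
  filter_upwards [(continuousOn_param hc (θ, t) ⟨hθ, ht⟩).eventually hzero, self_mem_nhdsWithin]
    with p hp hpI
  rw [(h.eq_zero_iff θ hθ t ht _).2 rfl] at hp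
  exact ((h.eq_zero_iff p.1 hpI.1 p.2 hpI.2 _).1 hp).symm

theorem continuousOn (h : IsZeroFamily G Θ a b c x) (hc : ContinuousOn c (Icc a b)) :
    ContinuousOn (fun p : ℝ × ℝ => x p.1 p.2) (Θ ×ˢ Icc a b) := by
  rintro ⟨θ, t⟩ ⟨hθ, ht⟩
  obtain ⟨ψ, hψ, -, hxψ⟩ := h.exists_implicitFunction hc hθ ht
  have hcomp := ContinuousAt.comp_continuousWithinAt (f := fun p : ℝ × ℝ => (p.1, c p.2)) hψ
    (continuousOn_param (Θ := Θ) hc (θ, t) ⟨hθ, ht⟩)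
  exact hcomp.congr_of_eventuallyEq_of_mem hxψ ⟨hθ, ht⟩

theorem continuousOn_zeroDeriv (h : IsZeroFamily G Θ a b c x) (hc : ContinuousOn c (Icc a b)) :
    ContinuousOn (fun p : ℝ × ℝ => zeroDeriv G ((p.1, c p.2), x p.1 p.2)) (Θ ×ˢ Icc a b) := by
  rintro ⟨θ, t⟩ ⟨hθ, ht⟩
  exact ContinuousAt.comp_continuousWithinAt (f := fun p : ℝ × ℝ => ((p.1, c p.2), x p.1 p.2))
    (continuousAt_zeroDeriv h.contDiff (h.isInvertible θ hθ t ht))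
    ((continuousOn_param hc (θ, t) ⟨hθ, ht⟩).prodMk (h.continuousOn hc (θ, t) ⟨hθ, ht⟩))

theorem isPrimitive (h : IsZeroFamily G Θ a b c x) (hc : IsPrimitive a b c c') (hθ : θ ∈ Θ) :
    IsPrimitive a b (x θ) fun t => zeroDeriv G ((θ, c t), x θ t) (c' t) := by
  have hL : ContinuousOn (fun t => zeroDeriv G ((θ, c t), x θ t)) (Icc a b) :=
    ContinuousOn.uncurry_left (f := fun θ t => zeroDeriv G ((θ, c t), x θ t)) θ hθ
      (h.continuousOn_zeroDeriv hc.continuousOn)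
  refine hc.chain hL fun t ht => ?_
  obtain ⟨ψ, -, hψ, hxψ⟩ := h.exists_implicitFunction hc.continuousOn hθ ht
  have hslice : Tendsto (fun s => (θ, s)) (𝓝[Icc a b] t) (𝓝[Θ ×ˢ Icc a b] (θ, t)) :=
    (Continuous.prodMk_right θ).continuousWithinAt.tendsto_nhdsWithin fun _ hs => ⟨hθ, hs⟩
  have heq : ∀ᶠ s in 𝓝[Icc a b] t, x θ s = ψ (θ, c s) := hslice.eventually hxψ
  refine (hψ.isLittleO.comp_tendsto (hc.continuousOn t ht)).congr' ?_ .rfl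
  filter_upwards [heq] with s hs
  simp only [Function.comp_apply, hs, heq.self_of_nhdsWithin ht]

end IsZeroFamily

theorem IsZeroFamily.tendsto_normW11 {n : ℕ} [CompleteSpace 𝒜] [CompleteSpace W]
    {G : (ℝ × 𝒜) × E n → W} {Θ : Set ℝ} {a b θ₀ : ℝ} {c c' : ℝ → 𝒜} {x : ℝ → ℝ → E n}
    (h : IsZeroFamily G Θ a b c x) (hab : a ≤ b) (hc : IsPrimitive a b c c') (hθ₀ : θ₀ ∈ Θ) :
    Tendsto (fun θ => normW11 a b (x θ - x θ₀)) (𝓝[Θ] θ₀) (𝓝 0) :=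
  tendsto_normW11_of_tendstoUniformlyOn hab hc.integrableOn
    (eventually_mem_nhdsWithin.mono fun _ => h.isPrimitive hc) (h.isPrimitive hc hθ₀)
    (tendstoUniformlyOn_of_continuousOn_prod isCompact_Icc (h.continuousOn hc.continuousOn) hθ₀)
    (tendstoUniformlyOn_of_continuousOn_prod (f := fun θ t => zeroDeriv G ((θ, c t), x θ t))
      isCompact_Icc (h.continuousOn_zeroDeriv hc.continuousOn) hθ₀)

end ZeroFamily

section OptimalitySystem

variable {𝒜 V ι : Type*} [NormedAddCommGroup 𝒜] [NormedSpace ℝ 𝒜] [NormedAddCommGroup V]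
  [Fintype ι]

/-- The first order optimality system of the entropic risk as a function of the risk aversion `θ`,
the parameter `α` of the family `f` and the point `ξ`. -/
def optimalityMap [NormedSpace ℝ V] (f : ι → 𝒜 × V → ℝ) (p : (ℝ × 𝒜) × V) : V →L[ℝ] ℝ :=
  entropicGradient p.1.1 (fun k ξ => f k (p.1.2, ξ)) p.2

theorem contDiff_optimalityMap [NormedSpace ℝ V] {f : ι → 𝒜 × V → ℝ}
    (hf : ∀ k, ContDiff ℝ 2 (f k)) : ContDiff ℝ 1 (optimalityMap f) := by
  refine ContDiff.sum fun k _ => ContDiff.smul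
    (f := fun p : (ℝ × 𝒜) × V => Real.exp (p.1.1 * f k (p.1.2, p.2)))
    (g := fun p => fderiv ℝ (fun ξ => f k (p.1.2, ξ)) p.2) ?_ ?_
  · have hf1 : ContDiff ℝ 1 (f k) := (hf k).of_le one_le_two
    fun_prop
  · have hin : ContDiff ℝ 2 (Function.uncurry fun (p : (ℝ × 𝒜) × V) ξ => f k (p.1.2, ξ)) := by
      have := hf k
      unfold Function.uncurry
      fun_prop
    exact ContDiff.fderiv hin contDiff_snd (one_add_one_eq_two (R := WithTop ℕ∞)).le

variable [InnerProductSpace ℝ V] [FiniteDimensional ℝ V] [Nonempty ι]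

theorem isZeroFamily_optimalityMap {f : ι → 𝒜 × V → ℝ} (hf : ∀ k, ContDiff ℝ 2 (f k)) {m : ℝ}
    (hm : 0 < m) {a b : ℝ} {c : ℝ → 𝒜}
    (hconv : ∀ t ∈ Icc a b, ∀ k, StrongConvexOn univ m fun ξ => f k (c t, ξ)) {x : ℝ → ℝ → V}
    (hx : ∀ θ ∈ Ici 0, ∀ t ∈ Icc a b, entropicGradient θ (fun k ξ => f k (c t, ξ)) (x θ t) = 0) :
    IsZeroFamily (optimalityMap f) (Ici 0) a b c x where
  contDiff := contDiff_optimalityMap hf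
  isInvertible θ hθ t ht := by
    have hslice (k : ι) : ContDiff ℝ 2 fun ξ => f k (c t, ξ) := by
      have := hf k
      fun_prop
    have hpartial : fderiv ℝ (optimalityMap f) ((θ, c t), x θ t) ∘L .inr ℝ (ℝ × 𝒜) V =
        fderiv ℝ (entropicGradient θ fun k ξ => f k (c t, ξ)) (x θ t) :=
      (((contDiff_optimalityMap hf).differentiable one_ne_zero _).hasFDerivAt.comp (x θ t)
        (hasFDerivAt_prodMk_right (θ, c t) (x θ t))).fderiv.symm
    rw [hpartial]
    exact isInvertible_fderiv_entropicGradient hm hslice (hconv t ht) hθ _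
  eq_zero_iff θ hθ t ht ξ := by
    have hslice (k : ι) : ContDiff ℝ 2 fun ξ => f k (c t, ξ) := by
      have := hf k
      fun_prop
    refine ⟨fun hξ => ?_, fun hξ => hξ ▸ hx θ hθ t ht⟩
    exact eq_of_entropicGradient_eq_zero hm hslice (hconv t ht) hθ hξ (hx θ hθ t ht)

end OptimalitySystem

section ValueFunction

theorem strongConvexOn_quadEval {H : Type*} [NormedAddCommGroup H] [InnerProductSpace ℝ H]
    {a : QuadCoeff H} {μ : ℝ} (ha : ∀ h, μ * ‖h‖ ^ 2 ≤ inner ℝ h (a.1 h)) :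
    StrongConvexOn univ (2 * μ) (quadEval a) := by
  refine ⟨convex_univ, fun x _ z _ s t hs ht hst => ?_⟩
  obtain rfl : t = 1 - s := by linarith
  have hcomb : s • x + (1 - s) • z - a.2.1.1 = s • (x - a.2.1.1) + (1 - s) • (z - a.2.1.1) := by
    module
  have hdefect : quadEval a (s • x + (1 - s) • z) =
      s * quadEval a x + (1 - s) * quadEval a z - s * (1 - s) * inner ℝ (x - z) (a.1 (x - z)) := by
    rw [← sub_sub_sub_cancel_right x z a.2.1.1, quadEval, quadEval, quadEval, hcomb]
    simp only [map_add, map_sub, map_smul, inner_add_left, inner_add_right, inner_sub_left,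
      inner_sub_right, real_inner_smul_left, real_inner_smul_right]
    ring
  have hcoer := mul_le_mul_of_nonneg_left (ha (x - z)) (mul_nonneg hs ht)
  rw [hdefect]
  simp only [smul_eq_mul]
  linarith

theorem differentiable_quadEval {H : Type*} [NormedAddCommGroup H] [InnerProductSpace ℝ H]
    {a : QuadCoeff H} : Differentiable ℝ (quadEval a) :=
  ((contDiff_quadEval (N := 1)).comp (contDiff_prodMk_right a)).differentiable one_ne_zero

theorem inner_toEuclideanCLM_pos {d : ℕ} {M : Matrix (Fin d) (Fin d) ℝ} (hM : M.PosDef) {x : E d}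
    (hx : x ≠ 0) : 0 < inner ℝ x (Matrix.toEuclideanCLM (𝕜 := ℝ) M x) := by
  rw [Matrix.inner_toEuclideanCLM]
  exact hM.dotProduct_mulVec_pos fun h => hx (WithLp.ofLp_injective 2 h)

theorem isPositive_toEuclideanCLM {d : ℕ} {M : Matrix (Fin d) (Fin d) ℝ} (hM : M.PosSemidef) :
    (Matrix.toEuclideanCLM (𝕜 := ℝ) M).IsPositive :=
  (LinearMap.isPositive_toContinuousLinearMap_iff _).2 (Matrix.isPositive_toEuclideanLin_iff.2 hM)

namespace UncertainSystem

variable {n m r : ℕ} {ι : Type*} (S : UncertainSystem n m r ι) {y : ℝ → E r} {t T : ℝ}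

/-- The linear-quadratic problem of the parameter `k`. -/
def lqProblem (hΓ : ∀ k, (S.Γ k).PosDef) (hR : ∀ k, (S.R k).PosDef) (hQ : ∀ k, (S.Q k).PosDef)
    (k : ι) : LQProblem (E n) (E m) (E r) where
  A := Matrix.toEuclideanCLM (𝕜 := ℝ) (S.A k)
  B := LinearMap.toContinuousLinearMap S.B.toEuclideanLin
  C := LinearMap.toContinuousLinearMap S.C.toEuclideanLin
  W := Matrix.toEuclideanCLM (𝕜 := ℝ) (S.Γ k)⁻¹
  R := Matrix.toEuclideanCLM (𝕜 := ℝ) (S.R k)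
  Rinv := Matrix.toEuclideanCLM (𝕜 := ℝ) (S.R k)⁻¹
  Q := Matrix.toEuclideanCLM (𝕜 := ℝ) (S.Q k)⁻¹
  W_isPositive := isPositive_toEuclideanCLM (hΓ k).inv.posSemidef
  inner_W_pos _ hh := inner_toEuclideanCLM_pos (hΓ k).inv hh
  Rinv_R u := by
    rw [← mul_apply_eq_comp, ← map_mul,
      Matrix.nonsing_inv_mul _ ((Matrix.isUnit_iff_isUnit_det _).1 (hR k).isUnit), map_one]
    rfl
  Rinv_isPositive := isPositive_toEuclideanCLM (hR k).inv.posSemidef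
  Q_isPositive := isPositive_toEuclideanCLM (hQ k).inv.posSemidef

section Value

variable (hΓ : ∀ k, (S.Γ k).PosDef) (hR : ∀ k, (S.R k).PosDef) (hQ : ∀ k, (S.Q k).PosDef) (k : ι)

theorem cost_eq_lqProblem_cost (ht : 0 ≤ t) (x : ℝ → E n) (v : ℝ → E m) :
    S.cost y k t x v = (S.lqProblem hΓ hR hQ k).cost S.x₀ y t x v := by
  rw [cost, integral_Ioo_eq_intervalIntegral ht]
  rfl

theorem admissible_iff_isTrajectory (ht : 0 < t) (ξ : E n) (x : ℝ → E n) (v : ℝ → E m) :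
    S.Admissible k t ξ x v ↔ (S.lqProblem hΓ hR hQ k).IsTrajectory t x v ∧ x t = ξ := by
  set P := S.lqProblem hΓ hR hQ k
  have hrhs (hx : ContinuousOn x (Icc 0 t)) (hv : MemLp v 2 (volume.restrict (Ioo 0 t))) :
      MemLp (fun s => P.A (x s) + P.B (v s)) 2 (volume.restrict (Ioo 0 t)) :=
    (memLp_of_continuousOn_Icc (P.A.continuous.comp_continuousOn hx)).add (P.B.comp_memLp' hv)
  constructor
  · rintro ⟨hx, -, hv, hw, hxt⟩
    exact ⟨⟨hw.isPrimitive ht hx ((hrhs hx hv).integrable one_le_two), hv⟩, hxt⟩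
  · rintro ⟨⟨hx, hv⟩, hxt⟩
    exact ⟨hx.continuousOn, hx.memW1 ht.le (hrhs hx.continuousOn hv), hv,
      hx.hasWeakDeriv ht.le, hxt⟩

theorem value_eq_quadEval (hy : MemLpI 2 0 T y) (ht : t ∈ Icc 0 T) :
    S.value y k t = quadEval ((S.lqProblem hΓ hR hQ k).coeff S.x₀ y t) := by
  funext ξ
  have hyt : MemLp y 2 (volume.restrict (Ioo 0 t)) :=
    hy.mono_measure (Measure.restrict_mono (Ioo_subset_Ioo_right ht.2) le_rfl)
  have hleast := (S.lqProblem hΓ hR hQ k).isLeast_cost (x₀ := S.x₀) ht.1 hyt ξ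
  rcases ht.1.eq_or_lt with rfl | hpos
  · obtain ⟨x, v, -, hx, hval⟩ := hleast.1
    rw [value, if_neg (lt_irrefl 0), hval, LQProblem.cost, intervalIntegral.integral_same,
      add_zero, hx]
    rfl
  · rw [value, if_pos hpos, ← hleast.csInf_eq]
    simp only [S.admissible_iff_isTrajectory hΓ hR hQ k hpos,
      S.cost_eq_lqProblem_cost hΓ hR hQ k hpos.le, and_assoc]

include hΓ hR hQ in
theorem exists_strongConvexOn_value [Finite ι] [Nonempty ι] (hy : MemLpI 2 0 T y) :
    ∃ μ > 0, ∀ t ∈ Icc 0 T, ∀ k, StrongConvexOn univ μ (S.value y k t) := by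
  have hcoercive (k : ι) : ∃ μ > 0, ∀ t ∈ Icc 0 T, ∀ h,
      μ * ‖h‖ ^ 2 ≤ inner ℝ h ((S.lqProblem hΓ hR hQ k).riccati t h) := by
    obtain ⟨P', hP⟩ := (S.lqProblem hΓ hR hQ k).exists_isPrimitive_riccati T
    exact exists_coercive_of_isCompact isCompact_Icc hP.continuousOn fun t ht h hh =>
      (S.lqProblem hΓ hR hQ k).inner_riccati_pos ht.1 hh
  choose μ hμ hμP using hcoercive
  obtain ⟨k₀, hk₀⟩ := Finite.exists_min μ
  refine ⟨2 * μ k₀, mul_pos two_pos (hμ k₀), fun t ht k => ?_⟩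
  rw [S.value_eq_quadEval hΓ hR hQ k hy ht]
  exact (strongConvexOn_quadEval (hμP k t ht)).mono
    (mul_le_mul_of_nonneg_left (hk₀ k) zero_le_two)

include hΓ hR hQ in
theorem exists_isPrimitive_coeff [Fintype ι] (hy : MemLpI 2 0 T y) :
    ∃ c c' : ℝ → ι → QuadCoeff (E n), IsPrimitive 0 T c c' ∧
      ∀ t ∈ Icc 0 T, ∀ k, S.value y k t = quadEval (c t k) := by
  choose c' hc using fun k => (S.lqProblem hΓ hR hQ k).exists_isPrimitive_coeff S.x₀ hy
  exact ⟨_, _, .pi hc, fun t ht k => S.value_eq_quadEval hΓ hR hQ k hy ht⟩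

end Value

variable [Fintype ι]

/-- The minimizer `x̂_θ(t)` for `θ ≥ 0`, where `θ = 0` stands for the risk-neutral minimizer
`x̂_0(t)` rather than for the junk value of `entropicRisk` at `θ = 0`. -/
def minimizer (y : ℝ → E r) : ℝ → ℝ → E n := Function.update (S.xhat y) 0 (S.xhatZero y)

theorem minimizer_zero : S.minimizer y 0 = S.xhatZero y := Function.update_self ..

theorem minimizer_of_pos {θ : ℝ} (hθ : 0 < θ) : S.minimizer y θ = S.xhat y θ :=
  Function.update_of_ne hθ.ne' ..

variable [Nonempty ι] {μ : ℝ}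

theorem entropicGradient_minimizer (hμ : 0 < μ) (hd : ∀ k, Differentiable ℝ (S.value y k t))
    (hconv : ∀ k, StrongConvexOn univ μ (S.value y k t)) {θ : ℝ} (hθ : 0 ≤ θ) :
    entropicGradient θ (fun k => S.value y k t) (S.minimizer y θ t) = 0 := by
  rcases hθ.eq_or_lt with rfl | hpos
  · rw [minimizer_zero]
    exact entropicGradient_argmin_expectation hμ hd hconv
  · rw [S.minimizer_of_pos hpos]
    exact entropicGradient_argmin_entropicRisk hμ hd hconv hpos

theorem isZeroFamily_minimizer {c : ℝ → ι → QuadCoeff (E n)} (hμ : 0 < μ)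
    (hc : ∀ t ∈ Icc 0 T, ∀ k, S.value y k t = quadEval (c t k))
    (hconv : ∀ t ∈ Icc 0 T, ∀ k, StrongConvexOn univ μ (S.value y k t)) :
    IsZeroFamily (optimalityMap fun k (p : (ι → QuadCoeff (E n)) × E n) => quadEval (p.1 k) p.2)
      (Ici 0) 0 T c (S.minimizer y) := by
  have hf (k : ι) : ContDiff ℝ 2 fun p : (ι → QuadCoeff (E n)) × E n => quadEval (p.1 k) p.2 :=
    contDiff_quadEval.comp (((contDiff_apply ℝ _ k).comp contDiff_fst).prodMk contDiff_snd)
  refine isZeroFamily_optimalityMap hf hμ (fun t ht k => ?_) fun θ hθ t ht => ?_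
  · simpa only [hc t ht k] using hconv t ht k
  have hd (k : ι) : Differentiable ℝ (S.value y k t) := hc t ht k ▸ differentiable_quadEval
  have hgrad := S.entropicGradient_minimizer hμ hd (hconv t ht) hθ
  simpa only [hc t ht] using hgrad

theorem tendstoUniformlyOn_xhat {s : Set ℝ} (hμ : 0 < μ)
    (hd : ∀ t ∈ s, ∀ k, Differentiable ℝ (S.value y k t))
    (hconv : ∀ t ∈ s, ∀ k, StrongConvexOn univ μ (S.value y k t)) :
    TendstoUniformlyOn (S.xhat y) (S.xhatInfty y) atTop s := by
  have hrate : Tendsto (fun θ : ℝ => 4 / μ * (Real.log (Fintype.card ι) / θ)) atTop (𝓝 0) := by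
    simpa using (tendsto_const_nhds.div_atTop tendsto_id).const_mul (4 / μ)
  refine Metric.tendstoUniformlyOn_iff.2 fun ε hε => ?_
  filter_upwards [hrate.eventually_lt_const (pow_pos hε 2), eventually_gt_atTop 0]
    with θ hθε hθ t ht
  rw [dist_eq_norm']
  exact lt_of_pow_lt_pow_left₀ 2 hε.le <| hθε.trans_le' <|
    norm_argmin_entropicRisk_sub_argmin_worstCase_le hμ (hd t ht) (hconv t ht) hθ

end UncertainSystem

end ValueFunction

end RiskAverseKalman

end

open RiskAverseKalman in
theorem proposition4p3_general {n m r : ℕ} {ι : Type*} [Fintype ι] [Nonempty ι]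
    (S : UncertainSystem n m r ι)
    (hΓ : ∀ k, (S.Γ k).PosDef) (hR : ∀ k, (S.R k).PosDef) (hQ : ∀ k, (S.Q k).PosDef)
    (T : ℝ) (hT : 0 < T) (y : ℝ → E r) (hy : MemLpI 2 0 T y) :
    ((∀ θ : ℝ, 0 < θ → MemW1 1 0 T (S.xhat y θ)) ∧ MemW1 1 0 T (S.xhatZero y) ∧
      Tendsto (fun θ : ℝ => normW11 0 T (S.xhat y θ - S.xhatZero y)) (𝓝[>] 0) (𝓝 0)) ∧
    (∀ θ : ℝ, 0 < θ → ContinuousOn (S.xhat y θ) (Icc 0 T)) ∧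
      ContinuousOn (S.xhatInfty y) (Icc 0 T) ∧
      TendstoUniformlyOn (S.xhat y) (S.xhatInfty y) atTop (Icc 0 T) := by
  obtain ⟨μ, hμ, hconv⟩ := S.exists_strongConvexOn_value hΓ hR hQ hy
  obtain ⟨c, c', hc, hval⟩ := S.exists_isPrimitive_coeff hΓ hR hQ hy
  have hzero := S.isZeroFamily_minimizer hμ hval hconv
  have hW (θ : ℝ) (hθ : 0 ≤ θ) : MemW1 1 0 T (S.minimizer y θ) :=
    (hzero.isPrimitive hc hθ).memW1 hT.le
      (memLp_one_iff_integrable.2 (hzero.isPrimitive hc hθ).integrableOn)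
  have hlim := (hzero.tendsto_normW11 hT.le hc self_mem_Ici).mono_left
    (nhdsWithin_mono 0 Ioi_subset_Ici_self)
  have hcont (θ : ℝ) (hθ : 0 < θ) : ContinuousOn (S.xhat y θ) (Icc 0 T) :=
    S.minimizer_of_pos hθ ▸ (hzero.isPrimitive hc hθ.le).continuousOn
  have hunif := S.tendstoUniformlyOn_xhat hμ
    (fun t ht k => hval t ht k ▸ differentiable_quadEval) hconv
  refine ⟨⟨fun θ hθ => S.minimizer_of_pos hθ ▸ hW θ hθ.le, S.minimizer_zero ▸ hW 0 le_rfl,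
    hlim.congr' ?_⟩, hcont, ?_, hunif⟩
  · filter_upwards [self_mem_nhdsWithin] with θ hθ
    rw [S.minimizer_of_pos hθ, S.minimizer_zero]
  · exact hunif.continuousOn ((eventually_gt_atTop 0).mono hcont).frequently

open RiskAverseKalman in
theorem proposition4p3 {n m r : ℕ} {ι : Type*} [Fintype ι] [Nonempty ι]
    (S : UncertainSystem n m r ι)
    (hΓ : ∀ k, (S.Γ k).PosDef) (hR : ∀ k, (S.R k).PosDef) (hQ : ∀ k, (S.Q k).PosDef)
    (T : ℝ) (hT : 0 < T) (y : ℝ → E r) (hy : MemLpI 2 0 T y) :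
    ((∀ θ : ℝ, 0 < θ → MemW1 1 0 T (S.xhat y θ)) ∧ MemW1 1 0 T (S.xhatZero y) ∧
      Tendsto (fun θ : ℝ => normW11 0 T (S.xhat y θ - S.xhatZero y)) (𝓝[>] 0) (𝓝 0)) ∧
    (∀ p : ℝ≥0∞, 1 ≤ p → p ≠ ⊤ →
      (∀ θ : ℝ, 0 < θ → MemLpI p 0 T (S.xhat y θ)) ∧ MemLpI p 0 T (S.xhatInfty y) ∧
      Tendsto (fun θ : ℝ => normLp p 0 T (S.xhat y θ - S.xhatInfty y)) atTop (𝓝 0)) := by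
  obtain ⟨hW, hcont, hcontInfty, hunif⟩ := proposition4p3_general S hΓ hR hQ T hT y hy
  exact ⟨hW, fun p _ _ => ⟨fun θ hθ => memLp_of_continuousOn_Icc (hcont θ hθ),
    memLp_of_continuousOn_Icc hcontInfty, tendsto_normLp_of_tendstoUniformlyOn hunif⟩⟩
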